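/- Setting. Let $T\ge 1$, let $\Omega_{\rm loc}\subseteq\mathbb R^d$ be closed, $\Omega^t:=(\Omega_{\rm loc})^t$ ($\Omega^0$ is one point), $\Omega:=\Omega^T$. $\|\cdot\|$ is the Euclidean norm; $\mathcal M_1^q$ is the set of Borel probability measures on $\Omega_{\rm loc}$ with finite $q$-th moment, and $d_{W_q}$ is the Wasserstein distance of order $q$. A map $f$ from $\Omega^t$ to a metric space is called $L$-Lipschitz if $d(f(\omega),f(\widetilde\omega))\le L\sum_{i=1}^t\|\omega_i-\widetilde\omega_i\|$ for all $\omega,\widetilde\omega\in\Omega^t$. Controls. $\mathcal A_0\subseteq\mathbb R^{m_0}$ is non-empty and compact. For $t=1,\dots,T-1$ the correspondence $\omega\mapsto\mathcal A_t(\omega)\subseteq\mathbb R^{m_t}$ on $\Omega^t$ is non-empty, compact-valued and upper hemicontinuous, and there is $L_{\mathcal A,t}\ge0$ such that for all $\omega,\widetilde\omega\in\Omega^t$ and $a\in\mathcal A_t(\omega)$ there is $\widetilde a\in\mathcal A_t(\widetilde\omega)$ with $\|a-\widetilde a\|\le L_{\mathcal A,t}\sum_{i=1}^t\|\omega_i-\widetilde\omega_i\|$.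 Let $\mathfrak A$ be the set of $\mathbf a=(a_t)_{t=0}^{T-1}$ with $a_t:\Omega^t\to\mathbb R^{m_t}$ Borel measurable and $a_t(\cdot)\in\mathcal A_t(\cdot)$. Let $\Omega\times\mathcal A^T$ be the set of $(\omega,a)$ with $\omega\in\Omega$ and $a_t\in\mathcal A_t(\omega_1,\dots,\omega_t)$ for $t=0,\dots,T-1$. Utility. Let $p\in\mathbb N_0$. $\Psi:\Omega\times\mathcal A^T\to\mathbb R$ satisfies, for some $L_\Psi\ge0$, $\alpha\in(0,1]$, $C_\Psi\ge1$ and all $(\omega,a),(\widetilde\omega,\widetilde a)$ in its domain, $$|\Psi(\omega,a)-\Psi(\widetilde\omega,\widetilde a)|\le L_\Psi\sum_{i=1}^T\big(\|\omega_i-\widetilde\omega_i\|^\alpha+\|a_{i-1}-\widetilde a_{i-1}\|^\alpha\big),\qquad |\Psi(\omega,a)|\le C_\Psi\Big(1+\sum_{i=1}^T\|\omega_i\|^p\Big).$$ For $\mathbf a\in\mathfrak A$ write $\Psi(\mathbf a)$ for $\omega\mapsto\Psi(\omega,(a_0,a_1(\omega_1),\dots,a_{T-1}(\omega_1,\dots,\omega_{T-1})))$.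 Measures and values. Let $\mathbb P^{\rm TR}_t,\widehat{\mathbb P}_t$ ($t=0,\dots,T-1$) be probability kernels from $\Omega^t$ to $\Omega_{\rm loc}$ (the true and the reference kernels), $\mathbb P^{\rm TR}:=\mathbb P^{\rm TR}_0\otimes\dots\otimes\mathbb P^{\rm TR}_{T-1}$, $\widehat{\mathbb P}:=\widehat{\mathbb P}_0\otimes\dots\otimes\widehat{\mathbb P}_{T-1}$, and $$\mathcal V^{\rm TR}:=\sup_{\mathbf a\in\mathfrak A}\mathbb E_{\mathbb P^{\rm TR}}[\Psi(\mathbf a)],\qquad \widehat{\mathcal V}:=\sup_{\mathbf a\in\mathfrak A}\mathbb E_{\widehat{\mathbb P}}[\Psi(\mathbf a)],\qquad \mathcal V:=\sup_{\mathbf a\in\mathfrak A}\inf_{\mathbb P\in\mathfrak P}\mathbb E_{\mathbb P}[\Psi(\mathbf a)],$$ where, for given sets $\mathcal P_t(\omega)$ of probability measures on $\Omega_{\rm loc}$, $\mathfrak P$ is the set of all $\mathbb P_0\otimes\dots\otimes\mathbb P_{T-1}$ with $\mathbb P_t$ a probability kernel such that $\mathbb P_t(\omega)\in\mathcal P_t(\omega)$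 for all $\omega\in\Omega^t$, $t<T$. For functions $f_s:\Omega^s\to[0,\infty]$, $s<T$, set $\mu_{s,s}:=f_s^\alpha$ and, for $t<s$, $\mu_{s,t}(\omega):=\mathbb E_{\mathbb P^{\rm TR}_t(\omega)}[\mu_{s,t+1}(\omega,\cdot)]$, $\omega\in\Omega^t$. Write $\mu^{\rm err,\alpha}_{s,t}$ if $f_s(\omega)=d_{W_1}(\mathbb P^{\rm TR}_s(\omega),\widehat{\mathbb P}_s(\omega))$ and $\mu^{\varepsilon,\alpha}_{s,t}$ if $f_s=\varepsilon_s$. For non-negative $(L_u)$ let $w_s(L):=2^{T-(s+1)}\prod_{u=s+1}^{T-1}\max\{L_{\mathcal A,u}^\alpha+L_u^\alpha,1\}$. Theorem 5.1. (1) Stability. Assume that for $t=1,\dots,T-1$ the maps $\omega\mapsto\widehat{\mathbb P}_t(\omega)$ and $\omega\mapsto\mathbb P^{\rm TR}_t(\omega)$ take values in $\mathcal M_1^{\max\{1,p\}}$ and are Lipschitz for $d_{W_1}$ with constants $L_{\widehat{\mathbb P},t}$ and $L_{\mathbb P^{\rm TR},t}$, that $\mathbb P^{\rm TR}_0,\widehat{\mathbb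 P}_0\in\mathcal M_1^{\max\{1,p\}}$, and that $\mu^{\rm err,\alpha}_{s,t}<\infty$ everywhere for $0\le t\le s\le T-1$. Then $\Psi(\mathbf a)$ is integrable under $\mathbb P^{\rm TR}$ and $\widehat{\mathbb P}$ for every $\mathbf a\in\mathfrak A$, the values are finite, and $$|\mathcal V^{\rm TR}-\widehat{\mathcal V}|\le L_\Psi\sum_{s=0}^{T-1}w_s(L_{\widehat{\mathbb P}})\,\mu^{\rm err,\alpha}_{s,0}<\infty .$$ In (2) and (3), let $\varepsilon_0\ge0$ and, for $t=1,\dots,T-1$, let $\varepsilon_t:\Omega^t\to[0,\overline\varepsilon_t]$ be $L_{\varepsilon,t}$-Lipschitz, where $0<\overline\varepsilon_t<\infty$. (2) Wasserstein uncertainty. Let $q\in\mathbb N$, $q\ge1$, $p<q$, let $\Omega_{\rm loc}$ be convex, let $\widehat{\mathbb P}_0\in\mathcal M_1^q$, let $\omega\mapsto\widehat{\mathbb P}_t(\omega)\in\mathcal M_1^q$ be $L_{\widehat{\mathbb P},t}$-Lipschitz for $d_{W_q}$ ($t=1,\dots,T-1$), and let $\mathcal P_t(\omega):=\{\mathbb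 P\in\mathcal M_1^q: d_{W_q}(\widehat{\mathbb P}_t(\omega),\mathbb P)\le\varepsilon_t(\omega)\}$ for $t=0,\dots,T-1$. Assume that $\omega\mapsto\mathbb P^{\rm TR}_t(\omega)\in\mathcal M_1^{\max\{1,p\}}$ is Lipschitz for $d_{W_1}$ with a constant $L_{\mathbb P^{\rm TR},t}$ ($t=1,\dots,T-1$) and $\mathbb P^{\rm TR}_t(\omega)\in\mathcal P_t(\omega)$ for all $\omega\in\Omega^t$, $t=0,\dots,T-1$. Then $\Psi(\mathbf a)$ is integrable under $\mathbb P^{\rm TR}$ and every $\mathbb P\in\mathfrak P$ for every $\mathbf a\in\mathfrak A$, the values are finite, and $$0\le\mathcal V^{\rm TR}-\mathcal V\le 2^\alpha L_\Psi\sum_{s=0}^{T-1}w_s(L_{\widehat{\mathbb P}}+L_\varepsilon)\,\mu^{\varepsilon,\alpha}_{s,0}<\infty .$$ (3) Parameter uncertainty. For $t=0,\dots,T-1$ let $\Theta_t\subseteq\mathbb R^{D_t}$ be non-empty, convex and closed, and let $(\mathbb P_\theta)_{\theta\in\Theta_t}\subseteq\mathcal M_1^{\max\{1,p\}}$ be a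 family (which may depend on $t$) such that $d_{W_{\max\{1,p\}}}(\mathbb P_\theta,\mathbb P_{\theta'})\le L_{\mathbb P_\theta,t}\|\theta-\theta'\|$ for $\theta,\theta'\in\Theta_t$. Let $\widehat\theta_0,\theta^{\rm TR}_0\in\Theta_0$, and for $t=1,\dots,T-1$ let $\widehat\theta_t,\theta^{\rm TR}_t:\Omega^t\to\Theta_t$ be Lipschitz with constants $L_{\widehat\theta,t}$, $L_{\theta^{\rm TR},t}$. Assume $\widehat{\mathbb P}_t(\omega)=\mathbb P_{\widehat\theta_t(\omega)}$, $\mathbb P^{\rm TR}_t(\omega)=\mathbb P_{\theta^{\rm TR}_t(\omega)}$ and $\|\theta^{\rm TR}_t(\omega)-\widehat\theta_t(\omega)\|\le\varepsilon_t(\omega)$ for all $\omega\in\Omega^t$, $t=0,\dots,T-1$, and let $\mathcal P_t(\omega):=\{\mathbb P_\theta:\theta\in\Theta_t,\ \|\theta-\widehat\theta_t(\omega)\|\le\varepsilon_t(\omega)\}$. Then $\Psi(\mathbf a)$ is integrable under $\mathbb P^{\rm TR}$ and every $\mathbb P\in\mathfrak P$ for every $\mathbf a\in\mathfrak A$, the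 values are finite, and $$0\le\mathcal V^{\rm TR}-\mathcal V\le 2^\alpha L_\Psi\sum_{s=0}^{T-1}w_s\big(L_{\mathbb P_\theta}(L_{\widehat\theta}+L_\varepsilon)\big)\,L_{\mathbb P_\theta,s}^\alpha\,\mu^{\varepsilon,\alpha}_{s,0}<\infty .$$ -/

import Mathlib

open MeasureTheory ProbabilityTheory
open scoped NNReal ENNReal

namespace RobustControl

noncomputable section

/-- `ℝⁿ` with the Euclidean norm. -/
abbrev Euc (n : ℕ) : Type := EuclideanSpace ℝ (Fin n)

/-- The `t`-fold product `X × ⋯ × X` (a single point for `t = 0`), with the product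
σ-algebra. -/
abbrev Hist (X : Type) (t : ℕ) : Type := Fin t → X

/-- The path `(ω₁, …, ω_t, x)`. -/
def snocHist {X : Type} {t : ℕ} (ω : Hist X t) (x : X) : Hist X (t + 1) :=
  Fin.snoc (α := fun _ => X) ω x

/-- The initial piece `(ω₁, …, ω_t)` of a path of length `T ≥ t`. -/
def initial {X : Type} {T t : ℕ} (h : t ≤ T) (ω : Hist X T) : Hist X t :=
  fun i => ω (Fin.castLE h i)

/-- The distance `∑ ‖ω_i - ω'_i‖` of two paths. -/
def pathDist {X : Type} [PseudoEMetricSpace X] {t : ℕ} (ω ω' : Hist X t) : ℝ≥0∞ :=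
  ∑ i, edist (ω i) (ω' i)

/-! ### Probability measures and Wasserstein distances -/

/-- The joint distributions of `μ` and `ν`. -/
def couplings {X : Type} [MeasurableSpace X] (μ ν : Measure X) : Set (Measure (X × X)) :=
  {π | π.map Prod.fst = μ ∧ π.map Prod.snd = ν}

/-- The Wasserstein distance of order `q`. -/
def wass {X : Type} [MeasurableSpace X] [PseudoEMetricSpace X] (q : ℕ) (μ ν : Measure X) :
    ℝ≥0∞ :=
  ⨅ π ∈ couplings μ ν, (∫⁻ z, edist z.1 z.2 ^ q ∂π) ^ (1 / (q : ℝ))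

/-- The probability measures on `S ⊆ ℝᵈ` with finite `q`-th moment. -/
def momentMeasures {d : ℕ} (S : Set (Euc d)) (q : ℕ) : Set (Measure S) :=
  {μ | IsProbabilityMeasure μ ∧ ∫⁻ x, ‖(x : Euc d)‖ₑ ^ q ∂μ < ∞}

/-- The closed Wasserstein ball of order `q` and radius `r` around `μ`. -/
def wassBall {d : ℕ} {S : Set (Euc d)} (q : ℕ) (μ : Measure S) (r : ℝ≥0) : Set (Measure S) :=
  {ν | ν ∈ momentMeasures S q ∧ wass q μ ν ≤ r}

/-- `P_0 ⊗ ⋯ ⊗ P_{t-1}`, the law on paths of length `t` obtained by drawing the coordinates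
successively from the transition kernels `P_0, P_1, …`. -/
def pathLaw {X : Type} [MeasurableSpace X] (P : (t : ℕ) → Kernel (Hist X t) X) :
    (t : ℕ) → Measure (Hist X t)
  | 0 => Measure.dirac Fin.elim0
  | t + 1 => ((pathLaw P t) ⊗ₘ (P t)).map (fun z => snocHist z.1 z.2)

/-- The laws `P_0 ⊗ ⋯ ⊗ P_{T-1}` for all measurable selections `P_t(·) ∈ Amb_t(·)` of probability
kernels. -/
def ambiguityLaws {X : Type} [MeasurableSpace X] (T : ℕ)
    (Amb : (t : ℕ) → Hist X t → Set (Measure X)) : Set (Measure (Hist X T)) :=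
  {μ | ∃ P : (t : ℕ) → Kernel (Hist X t) X, (∀ t, IsMarkovKernel (P t)) ∧
    (∀ t < T, ∀ ω, P t ω ∈ Amb t ω) ∧ μ = pathLaw P T}

/-- The kernels `P_t`, `t < T`, take values in the measures with finite `r`-th moment and are
`L_t`-Lipschitz for the Wasserstein distance of order `q`. (For `t = 0` there is only one path, and
the Lipschitz condition is void.) -/
structure LipschitzKernels {d : ℕ} {S : Set (Euc d)} (T r q : ℕ)
    (P : (t : ℕ) → Kernel (Hist S t) S) (L : ℕ → ℝ≥0) : Prop where
  moment : ∀ t < T, ∀ ω, P t ω ∈ momentMeasures S r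
  lipschitz : ∀ t < T, ∀ ω ω', wass q (P t ω) (P t ω') ≤ L t * pathDist ω ω'

/-! ### Controls and utility functions -/

/-- Conditions on the control correspondences `𝒜_t`, `t < T`. For `t = 0` there is only one
path, so that `𝒜_0` is a set, the condition on it is to be non-empty and compact, and the other
two conditions are void. -/
structure ControlAssumption {X : Type} [PseudoEMetricSpace X] (T : ℕ) {m : ℕ → ℕ}
    (𝒜 : (t : ℕ) → Hist X t → Set (Euc (m t))) (L : ℕ → ℝ≥0) : Prop where
  nonempty : ∀ t < T, ∀ ω, (𝒜 t ω).Nonempty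
  compact : ∀ t < T, ∀ ω, IsCompact (𝒜 t ω)
  upper : ∀ t < T, UpperHemicontinuous (𝒜 t)
  lipschitz : ∀ t < T, ∀ ω ω', ∀ a ∈ 𝒜 t ω, ∃ a' ∈ 𝒜 t ω', edist a a' ≤ L t * pathDist ω ω'

/-- The sequences of actions up to time `T`. -/
abbrev Actions (m : ℕ → ℕ) (T : ℕ) : Type := (t : Fin T) → Euc (m t)

/-- The set `Ω × 𝒜^T` of all paths together with admissible actions along the path. -/
def admissible {X : Type} {T : ℕ} {m : ℕ → ℕ} (𝒜 : (t : ℕ) → Hist X t → Set (Euc (m t))) :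
    Set (Hist X T × Actions m T) :=
  {z | ∀ t : Fin T, z.2 t ∈ 𝒜 t (initial t.isLt.le z.1)}

/-- Conditions on the utility function, which only concern its values on `Ω × 𝒜^T`. -/
structure UtilityAssumption {d : ℕ} {S : Set (Euc d)} {T : ℕ} {m : ℕ → ℕ}
    (𝒜 : (t : ℕ) → Hist S t → Set (Euc (m t))) (Ψ : Hist S T → Actions m T → ℝ)
    (p : ℕ) (α : ℝ) (L : ℝ≥0) : Prop where
  exponent_pos : 0 < α
  exponent_le : α ≤ 1
  holder : ∀ z ∈ admissible 𝒜, ∀ z' ∈ admissible 𝒜,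
    |Ψ z.1 z.2 - Ψ z'.1 z'.2| ≤
      L * ∑ i : Fin T, (dist (z.1 i) (z'.1 i) ^ α + dist (z.2 i) (z'.2 i) ^ α)
  growth : ∃ C : ℝ, 1 ≤ C ∧ ∀ z ∈ admissible 𝒜,
    |Ψ z.1 z.2| ≤ C * (1 + ∑ i : Fin T, ‖(z.1 i : Euc d)‖ ^ p)

/-- The controls: sequences of measurable selections `a_t(·) ∈ 𝒜_t(·)`, `t < T`. -/
def controls {X : Type} [MeasurableSpace X] (T : ℕ) {m : ℕ → ℕ}
    (𝒜 : (t : ℕ) → Hist X t → Set (Euc (m t))) : Set ((t : ℕ) → Hist X t → Euc (m t)) :=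
  {a | ∀ t < T, Measurable (a t) ∧ ∀ ω, a t ω ∈ 𝒜 t ω}

/-- The random variable `Ψ(a_0, …, a_{T-1})`. -/
def payoff {X : Type} {T : ℕ} {m : ℕ → ℕ} (Ψ : Hist X T → Actions m T → ℝ)
    (a : (t : ℕ) → Hist X t → Euc (m t)) (ω : Hist X T) : ℝ :=
  Ψ ω (fun t => a t (initial t.isLt.le ω))

/-- The value `sup_a E_μ[Ψ(a)]` of the control problem without model uncertainty. -/
def value {X : Type} [MeasurableSpace X] {T : ℕ} {m : ℕ → ℕ}
    (𝒜 : (t : ℕ) → Hist X t → Set (Euc (m t))) (Ψ : Hist X T → Actions m T → ℝ)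
    (μ : Measure (Hist X T)) : EReal :=
  ⨆ a ∈ controls T 𝒜, ((∫ ω, payoff Ψ a ω ∂μ : ℝ) : EReal)

/-- The value `sup_a inf_μ E_μ[Ψ(a)]` of the robust control problem. -/
def robustValue {X : Type} [MeasurableSpace X] {T : ℕ} {m : ℕ → ℕ}
    (𝒜 : (t : ℕ) → Hist X t → Set (Euc (m t))) (Ψ : Hist X T → Actions m T → ℝ)
    (M : Set (Measure (Hist X T))) : EReal :=
  ⨆ a ∈ controls T 𝒜, ⨅ μ ∈ M, ((∫ ω, payoff Ψ a ω ∂μ : ℝ) : EReal)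

/-! ### Iterated expectations and radii -/

/-- `iterExp P f n t ω` is the `n`-fold iterated expectation, over coordinates `t+1, …, t+n`
drawn from the kernels `P_t, …, P_{t+n-1}`, of the function `f (t+n)` of the path. -/
def iterExp {X : Type} [MeasurableSpace X] (P : (t : ℕ) → Kernel (Hist X t) X)
    (f : (t : ℕ) → Hist X t → ℝ≥0∞) : (n t : ℕ) → Hist X t → ℝ≥0∞
  | 0, t => f t
  | n + 1, t => fun ω => ∫⁻ x, iterExp P f n (t + 1) (snocHist ω x) ∂(P t ω)

/-- The quantities `μ_{s,t}`, `t ≤ s`: `μ_{s,s} = f_s ^ α` and `μ_{s,t}(ω)` is the expectation of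
`μ_{s,t+1}(ω, ·)` under `P_t(ω)`. -/
def muNested {X : Type} [MeasurableSpace X] (P : (t : ℕ) → Kernel (Hist X t) X) (α : ℝ)
    (f : (t : ℕ) → Hist X t → ℝ≥0∞) (s t : ℕ) : Hist X t → ℝ≥0∞ :=
  iterExp P (fun u ω => f u ω ^ α) (s - t) t

/-- Bounded `L_t`-Lipschitz radii `ε_t`, `t < T` (for `t = 0` just a number `ε_0 ≥ 0`). -/
structure RadiusAssumption {X : Type} [PseudoEMetricSpace X] (T : ℕ)
    (ε : (t : ℕ) → Hist X t → ℝ≥0) (L : ℕ → ℝ≥0) : Prop where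
  bounded : ∀ t < T, ∃ b : ℝ≥0, 0 < b ∧ ∀ ω, ε t ω ≤ b
  lipschitz : ∀ t < T, ∀ ω ω', edist (ε t ω) (ε t ω') ≤ L t * pathDist ω ω'

/-- A parametric family with reference parameters: for `t < T` the set `Θ_t` is non-empty, convex
and closed, `θ ↦ P_θ` is `L_t`-Lipschitz on `Θ_t` into the measures with finite `r`-th moment and
Wasserstein distance of order `r`, and the path-dependent reference parameter is `Lθ_t`-Lipschitz
with values in `Θ_t`. -/
structure ParametricAssumption {d : ℕ} {S : Set (Euc d)} (T r : ℕ) {D : ℕ → ℕ}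
    (Θ : (t : ℕ) → Set (Euc (D t))) (Pfam : (t : ℕ) → Euc (D t) → Measure S)
    (L : ℕ → ℝ≥0) (θ : (t : ℕ) → Hist S t → Euc (D t)) (Lθ : ℕ → ℝ≥0) : Prop where
  nonempty : ∀ t < T, (Θ t).Nonempty
  convex : ∀ t < T, Convex ℝ (Θ t)
  closed : ∀ t < T, IsClosed (Θ t)
  moment : ∀ t < T, ∀ x ∈ Θ t, Pfam t x ∈ momentMeasures S r
  lipschitz_family : ∀ t < T, ∀ x ∈ Θ t, ∀ y ∈ Θ t,
    wass r (Pfam t x) (Pfam t y) ≤ L t * edist x y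
  mem : ∀ t < T, ∀ ω, θ t ω ∈ Θ t
  lipschitz : ∀ t < T, ∀ ω ω', edist (θ t ω) (θ t ω') ≤ Lθ t * pathDist ω ω'

/-- The measures `P_x` with parameter `x ∈ Θ` at distance at most `r` from `θ`. -/
def paramBall {d k : ℕ} {S : Set (Euc d)} (Θ : Set (Euc k)) (Pfam : Euc k → Measure S)
    (θ : Euc k) (r : ℝ≥0) : Set (Measure S) :=
  {ν | ∃ x ∈ Θ, dist x θ ≤ r ∧ ν = Pfam x}

/-- The weight `2^(T-(s+1)) ∏_{u=s+1}^{T-1} max {LA_u^α + LP_u^α, 1}`. -/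
def weight (T : ℕ) (α : ℝ) (LA LP : ℕ → ℝ≥0) (s : ℕ) : ℝ≥0 :=
  2 ^ (T - (s + 1)) * ∏ u ∈ Finset.Ico (s + 1) T, max (LA u ^ α + LP u ^ α) 1

end

end RobustControl

open RobustControl

namespace RobustControl

noncomputable section

/-! ### Couplings, Wasserstein distances and integrals of Hölder functions -/

section Wasserstein

/-! All three parts come from one dynamic programme. On histories (ω, a) of states and actions put
V_T = Ψ and V_t(ω, a) = sup_b inf_Q ∫ V_{t+1}((ω, x), (a, b)) Q(dx), with b in 𝒜_t(ω) and Q in an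
ambiguity set Amb_t(ω). If these sets are L_t-Lipschitz in ω for the Wasserstein distance W of order
1, then backward induction shows that V_t is α-Hölder (`IsValueFunction.isHolderAt`): a step
multiplies the constant by at most 1 + LA_t^α + L_t^α ≤ 2 max(LA_t^α + L_t^α, 1). The constant
obtained for V_{s+1} is exactly L_Ψ w_s.

By a coupling and Jensen's inequality, the integrals of an α-Hölder function with constant H under
two measures differ by at most H W^α (`integral_sub_le_of_wass_le`). Exchanging a kernel P_s for a
member of Amb_s thus costs at most L_Ψ w_s W^α. Telescoping E_P[V_t] along the path law of P, with v
= V_0, gives two bounds. For every control, E_P[Ψ(a)] ≤ v + errors, where the error at time s must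
control all members of Amb_s (`integral_value_le_add_sum`). For a control made of Bellman
maximizers, v ≤ E_P[Ψ(a)] + errors, where closeness to one member suffices
(`le_integral_value_add_sum`).

Stability: take Amb_t to be the singleton of the reference kernel; then v is the reference value,
and the true kernels are inserted into both bounds. Robustness: the true kernel is within twice the
radius of each member, so 𝒱^TR ≤ v + errors; every law in 𝔓 has its own kernels as members, at zero
error, so v ≤ 𝒱; and 𝒱 ≤ 𝒱^TR because the true law lies in 𝔓. No worst-case kernel has to be
selected.

It remains to prove that the ambiguity sets are Lipschitz, by interpolation in Wasserstein balls or
along segments of parameters, and to select maximizers measurably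
(`IsValueFunction.exists_maximizer`). -/

theorem isProbabilityMeasure_of_mem_couplings {X : Type} [MeasurableSpace X]
    {μ ν : Measure X} [IsProbabilityMeasure μ]
    {π : Measure (X × X)} (hπ : π ∈ couplings μ ν) : IsProbabilityMeasure π := by
  have h : IsProbabilityMeasure (π.map Prod.fst) := by rw [hπ.1]; infer_instance
  exact (Measure.isProbabilityMeasure_map_iff measurable_fst.aemeasurable).1 h

variable {X : Type} [MetricSpace X]

/-- A function with `|f x - f y| ≤ H * dist x y ^ α`. -/
def IsHolder (f : X → ℝ) (H : ℝ≥0) (α : ℝ) : Prop :=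
  ∀ x y, |f x - f y| ≤ H * dist x y ^ α

theorem IsHolder.continuous {f : X → ℝ} {H : ℝ≥0} {α : ℝ} (hα : 0 < α) (hf : IsHolder f H α) :
    Continuous f := by
  rw [continuous_iff_continuousAt]
  intro x
  rw [ContinuousAt, tendsto_iff_dist_tendsto_zero]
  have h : Filter.Tendsto (fun y => (H : ℝ) * dist y x ^ α) (nhds x) (nhds 0) := by
    have : Continuous (fun y => (H : ℝ) * dist y x ^ α) :=
      continuous_const.mul
        ((continuous_id.dist continuous_const).rpow_const fun _ => Or.inr hα.le)
    simpa [Real.zero_rpow hα.ne'] using this.tendsto x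
  exact squeeze_zero (fun _ => dist_nonneg) (fun y => by simpa [Real.dist_eq] using hf y x) h

variable [MeasurableSpace X]

theorem exists_coupling_lt {q : ℕ} {μ ν : Measure X} {r : ℝ≥0∞} (h : wass q μ ν < r) :
    ∃ π ∈ couplings μ ν, (∫⁻ z, edist z.1 z.2 ^ q ∂π) ^ (1 / (q : ℝ)) < r := by
  simpa [wass, iInf_lt_iff] using h

theorem exists_coupling_lintegral_lt {μ ν : Measure X} {r : ℝ≥0∞} (h : wass 1 μ ν < r) :
    ∃ π ∈ couplings μ ν, ∫⁻ z, edist z.1 z.2 ∂π < r := by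
  simpa using exists_coupling_lt h

theorem wass_le_of_coupling {q : ℕ} {μ ν : Measure X} {π : Measure (X × X)}
    (hπ : π ∈ couplings μ ν) :
    wass q μ ν ≤ (∫⁻ z, edist z.1 z.2 ^ q ∂π) ^ (1 / (q : ℝ)) :=
  iInf₂_le π hπ

theorem wass_self [BorelSpace X] [SecondCountableTopology X] {q : ℕ} (hq : 1 ≤ q)
    (μ : Measure X) : wass q μ μ = 0 := by
  have hm : Measurable (fun x : X => (x, x)) := measurable_id.prodMk measurable_id
  have hπ : μ.map (fun x => (x, x)) ∈ couplings μ μ := by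
    constructor
    · rw [Measure.map_map measurable_fst hm]; exact Measure.map_id
    · rw [Measure.map_map measurable_snd hm]; exact Measure.map_id
  refine le_antisymm ((wass_le_of_coupling hπ).trans ?_) bot_le
  rw [lintegral_map (by fun_prop) hm]
  have hq' : (0 : ℝ) < q := by exact_mod_cast hq
  have : q ≠ 0 := by omega
  simp [this, hq', ENNReal.zero_rpow_of_pos]

theorem wass_comm_le (q : ℕ) (μ ν : Measure X) [BorelSpace X] [SecondCountableTopology X] :
    wass q μ ν ≤ wass q ν μ := by
  refine le_iInf₂ fun π hπ => ?_
  have hπ' : π.map Prod.swap ∈ couplings μ ν := by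
    constructor
    · rw [Measure.map_map measurable_fst measurable_swap]; exact hπ.2
    · rw [Measure.map_map measurable_snd measurable_swap]; exact hπ.1
  refine (wass_le_of_coupling hπ').trans_eq ?_
  rw [lintegral_map (by fun_prop) measurable_swap]
  simp [edist_comm]

theorem wass_comm (q : ℕ) (μ ν : Measure X) [BorelSpace X] [SecondCountableTopology X] :
    wass q μ ν = wass q ν μ :=
  le_antisymm (wass_comm_le q μ ν) (wass_comm_le q ν μ)

theorem lintegral_le_rpow_lintegral_pow {Ω : Type*} [MeasurableSpace Ω] {π : Measure Ω}
    [IsProbabilityMeasure π] {q : ℕ} (hq : 1 ≤ q) {f : Ω → ℝ≥0∞} (hf : AEMeasurable f π) :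
    ∫⁻ z, f z ∂π ≤ (∫⁻ z, f z ^ q ∂π) ^ (1 / (q : ℝ)) := by
  have h := eLpNorm'_le_eLpNorm'_of_exponent_le (μ := π) (f := f) (p := 1) (q := q)
    one_pos (by exact_mod_cast hq) hf.aestronglyMeasurable
  simpa [eLpNorm'] using h

theorem wass_one_le {q : ℕ} (hq : 1 ≤ q) (μ ν : Measure X) [IsProbabilityMeasure μ]
    [BorelSpace X] [SecondCountableTopology X] : wass 1 μ ν ≤ wass q μ ν := by
  refine le_iInf₂ fun π hπ => (wass_le_of_coupling hπ).trans ?_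
  have := isProbabilityMeasure_of_mem_couplings hπ
  simpa using lintegral_le_rpow_lintegral_pow hq
    (measurable_edist (α := X)).aemeasurable

/-- The triangle inequality integrated against an arbitrary coupling; it transfers first-moment
bounds between nearby measures. -/
theorem lintegral_edist_le_add_wass [BorelSpace X] [SecondCountableTopology X]
    (μ ν : Measure X) (o : X) :
    ∫⁻ x, edist x o ∂ν ≤ ∫⁻ x, edist x o ∂μ + wass 1 μ ν := by
  simp only [wass, ENNReal.add_iInf₂]
  refine le_iInf₂ fun π hπ => ?_
  have h1 : ∫⁻ x, edist x o ∂μ = ∫⁻ z, edist z.1 o ∂π := by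
    rw [← hπ.1, lintegral_map (by fun_prop) measurable_fst]
  have h2 : ∫⁻ x, edist x o ∂ν = ∫⁻ z, edist z.2 o ∂π := by
    rw [← hπ.2, lintegral_map (by fun_prop) measurable_snd]
  rw [h1, h2]
  simp only [pow_one, Nat.cast_one, ne_eq, one_ne_zero, not_false_eq_true, div_self,
    ENNReal.rpow_one]
  rw [← lintegral_add_left (by fun_prop)]
  refine lintegral_mono fun z => ?_
  rw [add_comm]
  simpa [edist_comm z.1 z.2] using edist_triangle z.2 z.1 o

/-- Gluing of couplings. -/
theorem wass_triangle [BorelSpace X] [SecondCountableTopology X] [StandardBorelSpace X]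
    [Nonempty X] {q : ℕ} (hq : 1 ≤ q) (μ ν ρ : Measure X) [IsProbabilityMeasure μ]
    [IsProbabilityMeasure ν] : wass q μ ρ ≤ wass q μ ν + wass q ν ρ := by
  conv_rhs => unfold wass
  refine ENNReal.le_iInf_add_iInf fun π₁ π₂ => ?_
  refine ENNReal.le_iInf_add_iInf fun h₁ h₂ => ?_
  have := isProbabilityMeasure_of_mem_couplings h₁
  have := isProbabilityMeasure_of_mem_couplings h₂
  -- The third point is drawn from the conditional law of `π₂` given the second point alone, so that
  -- `γ` has the pair marginals `π₁` and `π₂`.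
  let κ : Kernel (X × X) X := π₂.condKernel.comap Prod.snd measurable_snd
  let γ : Measure ((X × X) × X) := π₁ ⊗ₘ κ
  have hγ₁ : γ.map Prod.fst = π₁ := Measure.fst_compProd π₁ κ
  have hmap : Measurable (fun z : (X × X) × X => (z.1.2, z.2)) := by fun_prop
  have hγ₂ : γ.map (fun z => (z.1.2, z.2)) = π₂ := by
    have hd : π₂ = ν ⊗ₘ π₂.condKernel := by
      conv_lhs => rw [← π₂.disintegrate π₂.condKernel]
      rw [Measure.fst, h₂.1]
    ext s hs
    rw [Measure.map_apply hmap hs]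
    conv_rhs => rw [hd]
    rw [Measure.compProd_apply (hmap hs), Measure.compProd_apply hs, ← h₁.2,
      lintegral_map (Kernel.measurable_kernel_prodMk_left hs) measurable_snd]
    rfl
  have hmap' : Measurable (fun z : (X × X) × X => (z.1.1, z.2)) := by fun_prop
  have hπ : γ.map (fun z => (z.1.1, z.2)) ∈ couplings μ ρ := by
    constructor
    · rw [Measure.map_map measurable_fst hmap', ← h₁.1, ← hγ₁,
        Measure.map_map measurable_fst measurable_fst]
      rfl
    · rw [Measure.map_map measurable_snd hmap', ← h₂.2, ← hγ₂,
        Measure.map_map measurable_snd hmap]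
      rfl
  refine (wass_le_of_coupling hπ).trans ?_
  have hq' : (1 : ℝ) ≤ q := by exact_mod_cast hq
  have hL := ENNReal.lintegral_Lp_add_le (μ := γ)
    (f := fun z => edist z.1.1 z.1.2) (g := fun z => edist z.1.2 z.2)
    (by fun_prop) (by fun_prop) hq'
  simp only [ENNReal.rpow_natCast, Pi.add_apply] at hL
  rw [lintegral_map (by fun_prop) hmap']
  refine le_trans ?_ (hL.trans_eq ?_)
  · gcongr
    exact edist_triangle _ _ _
  · conv_rhs => rw [← hγ₁, ← hγ₂]
    rw [lintegral_map (by fun_prop) measurable_fst, lintegral_map (by fun_prop) hmap]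

theorem rpow_le_one_add {x α : ℝ} (hx : 0 ≤ x) (hα : 0 ≤ α) (hα1 : α ≤ 1) : x ^ α ≤ 1 + x := by
  rcases le_total x 1 with h | h
  · exact (Real.rpow_le_one hx h hα).trans (by linarith)
  · exact (Real.rpow_le_rpow_of_exponent_le h hα1).trans (by rw [Real.rpow_one]; linarith)

variable [BorelSpace X] [SecondCountableTopology X]

theorem integrable_dist {μ : Measure X} {o : X} (hμ : ∫⁻ x, edist x o ∂μ ≠ ∞) :
    Integrable (fun x => dist x o) μ := by
  refine ⟨by fun_prop, ?_⟩
  simpa [HasFiniteIntegral, Real.enorm_eq_ofReal dist_nonneg, ← edist_dist] using hμ.lt_top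

theorem IsHolder.integrable {f : X → ℝ} {H : ℝ≥0} {α : ℝ} (hα : 0 < α) (hα1 : α ≤ 1)
    (hf : IsHolder f H α) {μ : Measure X} [IsProbabilityMeasure μ] {o : X}
    (hμ : ∫⁻ x, edist x o ∂μ ≠ ∞) : Integrable f μ := by
  have hg : Integrable (fun x => |f o| + H * (1 + dist x o)) μ :=
    (integrable_const _).add (((integrable_const _).add (integrable_dist hμ)).const_mul _)
  refine hg.mono' (hf.continuous hα).measurable.aestronglyMeasurable (.of_forall fun x => ?_)
  have h1 := hf x o
  have h2 : (H : ℝ) * dist x o ^ α ≤ H * (1 + dist x o) :=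
    mul_le_mul_of_nonneg_left (rpow_le_one_add dist_nonneg hα.le hα1) H.2
  have h3 := abs_sub_abs_le_abs_sub (f x) (f o)
  rw [Real.norm_eq_abs]
  linarith

/-- Integrate the pointwise bound against a nearly optimal coupling, apply Jensen's inequality to
the concave power `α`, and let the cost decrease to `r`. Two functions are allowed because a Bellman
step compares continuation values of two different histories. -/
theorem integral_sub_le_of_wass_le {f g : X → ℝ} {c : ℝ} {H r : ℝ≥0} {α : ℝ} (hα : 0 < α)
    (hα1 : α ≤ 1) {μ ν : Measure X} [IsProbabilityMeasure μ] (hf : Integrable f μ)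
    (hg : Integrable g ν) (h : ∀ x y, f x - g y ≤ c + H * dist x y ^ α)
    (hr : wass 1 μ ν ≤ r) :
    ∫ x, f x ∂μ - ∫ x, g x ∂ν ≤ c + H * (r : ℝ) ^ α := by
  have key : ∀ s : ℝ≥0, r < s → ∫ x, f x ∂μ - ∫ x, g x ∂ν ≤ c + H * (s : ℝ) ^ α := by
    intro s hs
    obtain ⟨π, hπ, hlt⟩ := exists_coupling_lintegral_lt
      (hr.trans_lt (ENNReal.coe_lt_coe.2 hs))
    have := isProbabilityMeasure_of_mem_couplings hπ
    obtain ⟨rfl, rfl⟩ := hπ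
    have hd : Integrable (fun z : X × X => dist z.1 z.2) π := by
      refine ⟨by fun_prop, ?_⟩
      simpa [HasFiniteIntegral, Real.enorm_eq_ofReal dist_nonneg, ← edist_dist] using
        hlt.trans ENNReal.coe_lt_top
    have hda : Integrable (fun z : X × X => dist z.1 z.2 ^ α) π := by
      refine ((integrable_const (1 : ℝ)).add hd).mono'
        (measurable_dist.pow_const α).aestronglyMeasurable (.of_forall fun z => ?_)
      rw [Real.norm_of_nonneg (by positivity)]
      exact rpow_le_one_add dist_nonneg hα.le hα1
    have hfi : Integrable (fun z : X × X => f z.1) π := hf.comp_measurable measurable_fst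
    have hgi : Integrable (fun z : X × X => g z.2) π := hg.comp_measurable measurable_snd
    have hsle : ∫ z : X × X, dist z.1 z.2 ∂π ≤ s := by
      rw [integral_eq_lintegral_of_nonneg_ae (.of_forall fun _ => dist_nonneg) (by fun_prop)]
      refine ENNReal.toReal_le_of_le_ofReal s.2 ?_
      simpa [← edist_dist] using hlt.le
    rw [integral_map measurable_fst.aemeasurable hf.1,
      integral_map measurable_snd.aemeasurable hg.1, ← integral_sub hfi hgi]
    calc ∫ z, f z.1 - g z.2 ∂π ≤ ∫ z : X × X, c + H * dist z.1 z.2 ^ α ∂π :=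
          integral_mono (hfi.sub hgi) ((integrable_const _).add (hda.const_mul _))
            fun z => h z.1 z.2
      _ = c + H * ∫ z : X × X, dist z.1 z.2 ^ α ∂π := by
          rw [integral_add (integrable_const _) (hda.const_mul _), integral_const_mul]
          simp
      _ ≤ c + H * (∫ z : X × X, dist z.1 z.2 ∂π) ^ α := by
          gcongr
          exact (Real.concaveOn_rpow hα.le hα1).le_map_integral
            (continuousOn_id.rpow_const fun _ _ => Or.inr hα.le) isClosed_Ici
            (.of_forall fun _ => dist_nonneg) hd hda
      _ ≤ c + H * (s : ℝ) ^ α := by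
          gcongr
  have hcont : Continuous (fun s : ℝ≥0 => c + H * (s : ℝ) ^ α) :=
    continuous_const.add (continuous_const.mul
      (NNReal.continuous_coe.rpow_const fun _ => Or.inr hα.le))
  have ht := (hcont.tendsto r).mono_left (nhdsWithin_le_nhds (s := Set.Ioi r))
  exact ge_of_tendsto ht (Filter.eventually_of_mem self_mem_nhdsWithin key)

theorem IsHolder.integral_sub_le {f : X → ℝ} {H r : ℝ≥0} {α : ℝ} (hα : 0 < α) (hα1 : α ≤ 1)
    (hf : IsHolder f H α) {μ ν : Measure X} [IsProbabilityMeasure μ] [IsProbabilityMeasure ν]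
    {o : X} (hμ : ∫⁻ x, edist x o ∂μ ≠ ∞) (hν : ∫⁻ x, edist x o ∂ν ≠ ∞)
    (hr : wass 1 μ ν ≤ r) : ∫ x, f x ∂μ - ∫ x, f x ∂ν ≤ H * (r : ℝ) ^ α := by
  have := integral_sub_le_of_wass_le (c := 0) hα hα1 (hf.integrable hα hα1 hμ)
    (hf.integrable hα hα1 hν) (fun x y => by simpa using (le_abs_self _).trans (hf x y)) hr
  simpa using this

end Wasserstein

/-! ### Moments and interpolation of measures on subsets of Euclidean space -/

section Euclidean

variable {d : ℕ} {S : Set (Euc d)}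

theorem lintegral_edist_ne_top_of_mem_momentMeasures {r : ℕ} (hr : 1 ≤ r) {μ : Measure S}
    (hμ : μ ∈ momentMeasures S r) (o : S) : ∫⁻ x, edist x o ∂μ ≠ ∞ := by
  have := hμ.1
  have h1 : ∫⁻ x : S, ‖(x : Euc d)‖ₑ ∂μ < ∞ :=
    (lintegral_le_rpow_lintegral_pow hr (by fun_prop)).trans_lt
      (ENNReal.rpow_lt_top_of_nonneg (by positivity) hμ.2.ne)
  have h2 : ∫⁻ x, edist x o ∂μ ≤ ∫⁻ x : S, ‖(x : Euc d)‖ₑ + ‖(o : Euc d)‖ₑ ∂μ :=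
    lintegral_mono fun x => by
      rw [Subtype.edist_eq, edist_eq_enorm_sub]
      exact enorm_sub_le
  refine (h2.trans_lt ?_).ne
  rw [lintegral_add_right _ (by fun_prop)]
  simpa using h1

/-- Displacement interpolation between `μ` and `ν`. -/
theorem exists_wass_interpolation (hS : Convex ℝ S) {q : ℕ} (hq : 1 ≤ q) {μ ν : Measure S}
    (hμ : μ ∈ momentMeasures S q) (hν : ν ∈ momentMeasures S q) {r s : ℝ≥0}
    (h : wass q μ ν < r + s) :
    ∃ ρ ∈ momentMeasures S q, wass q μ ρ ≤ r ∧ wass q ρ ν ≤ s := by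
  obtain ⟨π, hπ, hlt⟩ := exists_coupling_lt h
  have := hμ.1
  have := hν.1
  have := isProbabilityMeasure_of_mem_couplings hπ
  have hpos : 0 < r + s := by
    have : (0 : ℝ≥0∞) < ((r + s : ℝ≥0) : ℝ≥0∞) := by
      rw [ENNReal.coe_add]; exact bot_le.trans_lt hlt
    exact_mod_cast this
  have hpos' : (0 : ℝ) < r + s := by exact_mod_cast hpos
  -- Stopping each segment at the fraction `r / (r + s)` splits a total cost below `r + s` into
  -- parts of at most `r` and `s`. The strict inequality supplies the coupling and makes the
  -- denominator positive.
  set l : ℝ := r / (r + s) with hl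
  have hl0 : 0 ≤ l := by positivity
  have hl1' : 1 - l = s / (r + s) := by rw [hl]; field_simp; ring
  have hl1 : 0 ≤ 1 - l := by rw [hl1']; positivity
  let M : S × S → S := fun z =>
    ⟨(1 - l) • (z.1 : Euc d) + l • (z.2 : Euc d), hS z.1.2 z.2.2 hl1 hl0 (by ring)⟩
  have hM : Measurable M := by
    apply Measurable.subtype_mk
    fun_prop
  have e1 : ∀ z, edist z.1 (M z) = ENNReal.ofReal l * edist z.1 z.2 := by
    intro z
    rw [edist_dist, edist_dist, ← ENNReal.ofReal_mul hl0, Subtype.dist_eq, Subtype.dist_eq,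
      dist_eq_norm, dist_eq_norm]
    congr 1
    have : (z.1 : Euc d) - (M z : Euc d) = l • ((z.1 : Euc d) - z.2) := by
      change (z.1 : Euc d) - ((1 - l) • (z.1 : Euc d) + l • (z.2 : Euc d)) = _
      module
    rw [this, norm_smul, Real.norm_of_nonneg hl0]
  have e2 : ∀ z, edist (M z) z.2 = ENNReal.ofReal (1 - l) * edist z.1 z.2 := by
    intro z
    rw [edist_dist, edist_dist, ← ENNReal.ofReal_mul hl1, Subtype.dist_eq, Subtype.dist_eq,
      dist_eq_norm, dist_eq_norm]
    congr 1
    have : (M z : Euc d) - (z.2 : Euc d) = (1 - l) • ((z.1 : Euc d) - z.2) := by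
      change ((1 - l) • (z.1 : Euc d) + l • (z.2 : Euc d)) - (z.2 : Euc d) = _
      module
    rw [this, norm_smul, Real.norm_of_nonneg hl1]
  have hq' : (0 : ℝ) < q := by exact_mod_cast hq
  have cost : ∀ c : ℝ, 0 ≤ c →
      (∫⁻ z : S × S, (ENNReal.ofReal c * edist z.1 z.2) ^ q ∂π) ^ (1 / (q : ℝ)) ≤
        ENNReal.ofReal c * (r + s) := by
    intro c hc
    simp only [mul_pow]
    rw [lintegral_const_mul _ (by fun_prop), ENNReal.mul_rpow_of_nonneg _ _ (by positivity),
      ← ENNReal.rpow_natCast, ← ENNReal.rpow_mul, mul_one_div_cancel hq'.ne', ENNReal.rpow_one]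
    gcongr
  have ofr : ∀ a : ℝ≥0, ENNReal.ofReal (a / (r + s)) * (r + s) = a := by
    intro a
    rw [← ENNReal.coe_add, ← ENNReal.ofReal_coe_nnreal (p := r + s),
      ← ENNReal.ofReal_mul (by positivity), NNReal.coe_add, div_mul_cancel₀ _ hpos'.ne',
      ENNReal.ofReal_coe_nnreal]
  have hc1 : Measurable (fun z : S × S => (z.1, M z)) := measurable_fst.prodMk hM
  have hc2 : Measurable (fun z : S × S => (M z, z.2)) := hM.prodMk measurable_snd
  refine ⟨π.map M, ⟨Measure.isProbabilityMeasure_map hM.aemeasurable, ?_⟩, ?_, ?_⟩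
  · rw [lintegral_map (by fun_prop) hM]
    have hle : ∀ z : S × S, ‖(M z : Euc d)‖ₑ ^ q ≤
        ‖(z.1 : Euc d)‖ₑ ^ q + ‖(z.2 : Euc d)‖ₑ ^ q := by
      intro z
      have hn : ‖(M z : Euc d)‖ ≤ max ‖(z.1 : Euc d)‖ ‖(z.2 : Euc d)‖ :=
        (convexOn_norm convex_univ).le_max_of_mem_segment trivial trivial
          ⟨1 - l, l, hl1, hl0, by ring, rfl⟩
      rcases le_max_iff.1 hn with hn | hn
      · exact le_add_right (pow_le_pow_left' (enorm_le_iff_norm_le.2 hn) q)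
      · exact le_add_left (pow_le_pow_left' (enorm_le_iff_norm_le.2 hn) q)
    refine (lintegral_mono hle).trans_lt ?_
    rw [lintegral_add_left (by fun_prop)]
    refine ENNReal.add_lt_top.2 ⟨?_, ?_⟩
    · have := hμ.2
      rwa [← hπ.1, lintegral_map (by fun_prop) measurable_fst] at this
    · have := hν.2
      rwa [← hπ.2, lintegral_map (by fun_prop) measurable_snd] at this
  · have hmem : π.map (fun z => (z.1, M z)) ∈ couplings μ (π.map M) := by
      constructor
      · rw [Measure.map_map measurable_fst hc1]; exact hπ.1
      · rw [Measure.map_map measurable_snd hc1]; rfl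
    refine (wass_le_of_coupling hmem).trans ?_
    rw [lintegral_map (by fun_prop) hc1]
    simp only [e1]
    exact (cost l hl0).trans_eq (ofr r)
  · have hmem : π.map (fun z => (M z, z.2)) ∈ couplings (π.map M) ν := by
      constructor
      · rw [Measure.map_map measurable_fst hc2]; rfl
      · rw [Measure.map_map measurable_snd hc2]; exact hπ.2
    refine (wass_le_of_coupling hmem).trans ?_
    rw [lintegral_map (by fun_prop) hc2]
    simp only [e2]
    refine (cost _ hl1).trans_eq ?_
    rw [hl1']; exact ofr s

end Euclidean

/-! ### Measurable selection from compact-valued correspondences -/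

section Selection

variable {Z Y : Type*} [MeasurableSpace Z] [TopologicalSpace Y]

/-- Non-empty compact-valued correspondences for which the lower inverse images of closed sets are
measurable. -/
structure IsMeasurableCorrespondence (M : Z → Set Y) : Prop where
  nonempty : ∀ z, (M z).Nonempty
  compact : ∀ z, IsCompact (M z)
  measurable : ∀ C, IsClosed C → MeasurableSet {z | (M z ∩ C).Nonempty}

/-- The minimizers of a continuous function depend measurably on the constraint set. -/
theorem IsMeasurableCorrespondence.minimizers {M : Z → Set Y}
    (hM : IsMeasurableCorrespondence M) {φ : Y → ℝ} (hφ : Continuous φ) :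
    IsMeasurableCorrespondence (fun z => {y ∈ M z | ∀ y' ∈ M z, φ y ≤ φ y'}) where
  nonempty z := by
    obtain ⟨y, hy, hmin⟩ := (hM.compact z).exists_isMinOn (hM.nonempty z) hφ.continuousOn
    exact ⟨y, hy, fun y' hy' => hmin hy'⟩
  compact z := by
    have : {y ∈ M z | ∀ y' ∈ M z, φ y ≤ φ y'} = M z ∩ ⋂ y' ∈ M z, {y | φ y ≤ φ y'} := by
      ext y; simp
    rw [this]
    exact (hM.compact z).inter_right
      (isClosed_biInter fun y' _ => isClosed_le hφ continuous_const)
  measurable C hC := by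
    -- Some minimizer over `M z` lies in `C` iff `M z` meets `C` and the minimum over `M z ∩ C` is
    -- no larger than that over `M z`. Comparing the minima on rational levels leaves a countable
    -- intersection.
    have : {z | ({y ∈ M z | ∀ y' ∈ M z, φ y ≤ φ y'} ∩ C).Nonempty} =
        {z | (M z ∩ C).Nonempty} ∩ ⋂ c : ℚ, ({z | (M z ∩ {y | φ y ≤ c}).Nonempty}ᶜ ∪
          {z | (M z ∩ (C ∩ {y | φ y ≤ c})).Nonempty}) := by
      ext z
      simp only [Set.mem_ofPred_eq, Set.mem_inter_iff, Set.mem_iInter, Set.mem_union,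
        Set.mem_compl_iff]
      constructor
      · rintro ⟨y, ⟨hy, hmin⟩, hyC⟩
        refine ⟨⟨y, hy, hyC⟩, fun c => ?_⟩
        by_cases h : (M z ∩ {y | φ y ≤ c}).Nonempty
        · obtain ⟨y', hy', hc⟩ := h
          exact Or.inr ⟨y, hy, hyC, (hmin y' hy').trans hc⟩
        · exact Or.inl h
      · rintro ⟨hne, hc⟩
        obtain ⟨y, hy, hmin⟩ := ((hM.compact z).inter_right hC).exists_isMinOn hne
          hφ.continuousOn
        refine ⟨y, ⟨hy.1, fun y' hy' => ?_⟩, hy.2⟩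
        by_contra! hlt
        obtain ⟨c, hc1, hc2⟩ := exists_rat_btwn hlt
        rcases hc c with h | ⟨x, hx, hxC, hxc⟩
        · exact h ⟨y', hy', hc1.le⟩
        · exact absurd (hmin ⟨hx, hxC⟩) (not_le.2 (lt_of_le_of_lt hxc hc2))
    rw [this]
    refine (hM.measurable C hC).inter (MeasurableSet.iInter fun c => ?_)
    have hcl : IsClosed {y | φ y ≤ c} := isClosed_le hφ continuous_const
    exact (hM.measurable _ hcl).compl.union (hM.measurable _ (hC.inter hcl))

/-- Measurable selection by successive minimization of the coordinates. -/
theorem IsMeasurableCorrespondence.exists_selection {n : ℕ} {M : Z → Set (Euc n)}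
    (hM : IsMeasurableCorrespondence M) : ∃ s : Z → Euc n, Measurable s ∧ ∀ z, s z ∈ M z := by
  -- Each minimization freezes one more coordinate. After `n` of them the set is a singleton, and
  -- preimages under the selection become lower inverse images.
  have key : ∀ k ≤ n, ∃ N : Z → Set (Euc n), IsMeasurableCorrespondence N ∧
      (∀ z, N z ⊆ M z) ∧ ∀ z, ∀ y ∈ N z, ∀ y' ∈ N z, ∀ i : Fin n, i.1 < k → y i = y' i := by
    intro k
    induction k with
    | zero => exact fun _ => ⟨M, hM, fun _ => subset_rfl, fun _ _ _ _ _ i hi => by omega⟩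
    | succ k ih =>
      intro hk
      obtain ⟨N, hN, hsub, heq⟩ := ih (by omega)
      have hφ : Continuous (fun y : Euc n => y ⟨k, hk⟩) := by fun_prop
      refine ⟨_, hN.minimizers hφ, fun z => (Set.sep_subset _ _).trans (hsub z), ?_⟩
      intro z y hy y' hy' i hi
      rcases Nat.lt_succ_iff_lt_or_eq.1 hi with h | h
      · exact heq z y hy.1 y' hy'.1 i h
      · have : i = ⟨k, hk⟩ := Fin.ext h
        subst this
        exact le_antisymm (hy.2 y' hy'.1) (hy'.2 y hy.1)
  obtain ⟨N, hN, hsub, heq⟩ := key n le_rfl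
  choose s hs using hN.nonempty
  refine ⟨s, measurable_of_isClosed fun C hC => ?_, fun z => hsub z (hs z)⟩
  have : s ⁻¹' C = {z | (N z ∩ C).Nonempty} := by
    ext z
    constructor
    · exact fun h => ⟨s z, hs z, h⟩
    · rintro ⟨y, hy, hyC⟩
      have : s z = y := by
        ext i
        exact heq z _ (hs z) _ hy i i.2
      rwa [Set.mem_preimage, this]
  rw [this]
  exact hN.measurable C hC

end Selection

/-! ### Paths and action histories -/

/-- Infinite sequences of actions, of which only the first `t` matter at time `t`. -/
abbrev ActionSeq (m : ℕ → ℕ) : Type := (i : ℕ) → Euc (m i)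

section Paths

variable {X : Type} {m : ℕ → ℕ}

theorem initial_snocHist {t i : ℕ} (h : i ≤ t) (ω : Hist X t) (x : X) :
    initial (h.trans t.le_succ) (snocHist ω x) = initial h ω := by
  funext j
  exact Fin.snoc_castSucc (α := fun _ => X) x ω (Fin.castLE h j)

theorem initial_self {t : ℕ} (ω : Hist X t) : initial le_rfl ω = ω := rfl

theorem snocHist_castSucc {t : ℕ} (ω : Hist X t) (x : X) (i : Fin t) :
    snocHist ω x i.castSucc = ω i :=
  Fin.snoc_castSucc (α := fun _ => X) x ω i

theorem snocHist_last {t : ℕ} (ω : Hist X t) (x : X) : snocHist ω x (Fin.last t) = x :=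
  Fin.snoc_last (α := fun _ => X) x ω

theorem init_snocHist {t : ℕ} (ω : Hist X t) (x : X) :
    Fin.init (α := fun _ => X) (snocHist ω x) = ω :=
  Fin.init_snoc (α := fun _ => X) x ω

/-- The first `t` actions are admissible along the path. -/
def AdmissibleAt (𝒜 : (t : ℕ) → Hist X t → Set (Euc (m t))) (t : ℕ) (ω : Hist X t)
    (a : ActionSeq m) : Prop :=
  ∀ i, ∀ hi : i < t, a i ∈ 𝒜 i (initial hi.le ω)

theorem AdmissibleAt.snoc {𝒜 : (t : ℕ) → Hist X t → Set (Euc (m t))} {t : ℕ} {ω : Hist X t}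
    {a : ActionSeq m} (ha : AdmissibleAt 𝒜 t ω a) {b : Euc (m t)} (hb : b ∈ 𝒜 t ω) (x : X) :
    AdmissibleAt 𝒜 (t + 1) (snocHist ω x) (Function.update a t b) := by
  intro i hi
  rcases Nat.lt_succ_iff_lt_or_eq.1 hi with h | rfl
  · rw [Function.update_of_ne h.ne, initial_snocHist h.le]
    exact ha i h
  · rw [Function.update_self, initial_snocHist le_rfl, initial_self]
    exact hb

end Paths

/-! ### The Hölder modulus on histories of states and actions -/

section Cost

variable {X : Type} [MetricSpace X] {m : ℕ → ℕ}

/-- The modulus `∑ (dist (ω i) (ω' i) ^ α + dist (a i) (a' i) ^ α)` over the first `t` times. -/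
def holderCost (α : ℝ) (t : ℕ) (ω ω' : Hist X t) (a a' : ActionSeq m) : ℝ :=
  ∑ i : Fin t, (dist (ω i) (ω' i) ^ α + dist (a i) (a' i) ^ α)

theorem holderCost_nonneg (α : ℝ) (t : ℕ) (ω ω' : Hist X t) (a a' : ActionSeq m) :
    0 ≤ holderCost α t ω ω' a a' :=
  Finset.sum_nonneg fun _ _ => by positivity

theorem holderCost_self {α : ℝ} (hα : 0 < α) (t : ℕ) (ω : Hist X t) (a : ActionSeq m) :
    holderCost α t ω ω a a = 0 := by
  simp [holderCost, Real.zero_rpow hα.ne']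

theorem holderCost_comm (α : ℝ) (t : ℕ) (ω ω' : Hist X t) (a a' : ActionSeq m) :
    holderCost α t ω ω' a a' = holderCost α t ω' ω a' a := by
  simp [holderCost, dist_comm]

theorem holderCost_snoc (α : ℝ) (t : ℕ) (ω ω' : Hist X t) (x x' : X) (a a' : ActionSeq m)
    (b b' : Euc (m t)) :
    holderCost α (t + 1) (snocHist ω x) (snocHist ω' x') (Function.update a t b)
        (Function.update a' t b') =
      holderCost α t ω ω' a a' + (dist x x' ^ α + dist b b' ^ α) := by
  rw [holderCost, Fin.sum_univ_castSucc, holderCost]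
  congr 1
  · refine Finset.sum_congr rfl fun i _ => ?_
    rw [snocHist_castSucc, snocHist_castSucc, Fin.val_castSucc,
      Function.update_of_ne i.2.ne, Function.update_of_ne i.2.ne]
  · rw [snocHist_last, snocHist_last]
    simp

theorem continuous_holderCost {α : ℝ} (hα : 0 < α) (t : ℕ) (ω : Hist X t) (a : ActionSeq m) :
    Continuous (fun z : Hist X t × ActionSeq m => holderCost α t z.1 ω z.2 a) := by
  unfold holderCost
  refine continuous_finsetSum _ fun i _ => ?_
  refine Continuous.add ?_ ?_
  · exact Continuous.rpow_const (by fun_prop) fun _ => Or.inr hα.le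
  · exact Continuous.rpow_const (by fun_prop) fun _ => Or.inr hα.le

theorem pathDist_eq_coe {t : ℕ} (ω ω' : Hist X t) :
    pathDist ω ω' = ((∑ i, nndist (ω i) (ω' i) : ℝ≥0) : ℝ≥0∞) := by
  simp only [pathDist, edist_nndist, ENNReal.ofNNReal_finsetSum]

theorem sum_rpow_le {ι : Type*} (s : Finset ι) (f : ι → ℝ≥0) {α : ℝ} (hα : 0 < α)
    (hα1 : α ≤ 1) : (∑ i ∈ s, f i) ^ α ≤ ∑ i ∈ s, f i ^ α := by
  classical
  induction s using Finset.induction_on with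
  | empty => simp [NNReal.zero_rpow hα.ne']
  | insert i s hi ih =>
    rw [Finset.sum_insert hi, Finset.sum_insert hi]
    exact (NNReal.rpow_add_le_add_rpow _ _ hα.le hα1).trans (by gcongr)

/-- Subadditivity of the power `α ≤ 1` converts Lipschitz bounds in the path into bounds by the
Hölder cost; the action terms are nonnegative and merely added. -/
theorem mul_sum_nndist_rpow_le {α : ℝ} (hα : 0 < α) (hα1 : α ≤ 1) {t : ℕ} (c : ℝ≥0)
    (ω ω' : Hist X t) (a a' : ActionSeq m) :
    ((c * ∑ i, nndist (ω i) (ω' i) : ℝ≥0) : ℝ) ^ α ≤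
      (c : ℝ) ^ α * holderCost α t ω ω' a a' := by
  rw [NNReal.coe_mul, Real.mul_rpow (NNReal.coe_nonneg c) (NNReal.coe_nonneg _)]
  refine mul_le_mul_of_nonneg_left ?_ (by positivity)
  have h := sum_rpow_le Finset.univ (fun i => nndist (ω i) (ω' i)) hα hα1
  have h' : ((∑ i, nndist (ω i) (ω' i) : ℝ≥0) : ℝ) ^ α ≤ ∑ i, dist (ω i) (ω' i) ^ α := by
    simpa [← NNReal.coe_le_coe] using h
  refine h'.trans (Finset.sum_le_sum fun i _ => ?_)
  have : 0 ≤ dist (a i) (a' i) ^ α := by positivity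
  linarith

/-- One-sided formulation of the Hölder condition at time `t`; it is symmetric. -/
def IsHolderAt (𝒜 : (t : ℕ) → Hist X t → Set (Euc (m t))) (α : ℝ) (t : ℕ)
    (W : Hist X t → ActionSeq m → ℝ) (H : ℝ≥0) : Prop :=
  ∀ ω ω' a a', AdmissibleAt 𝒜 t ω a → AdmissibleAt 𝒜 t ω' a' →
    W ω a ≤ W ω' a' + H * holderCost α t ω ω' a a'

end Cost

/-! ### Ambiguity sets and the Bellman operator -/

section Bellman

variable {X : Type} [MetricSpace X] [MeasurableSpace X] {m : ℕ → ℕ}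

/-- Non-empty sets of probability measures, with first moments of linear growth in the path, and
which are Lipschitz up to an arbitrarily small error. -/
structure AmbiguityAssumption (T : ℕ) (Amb : (t : ℕ) → Hist X t → Set (Measure X)) (o : X)
    (K L : ℕ → ℝ≥0) : Prop where
  nonempty : ∀ t < T, ∀ ω, (Amb t ω).Nonempty
  prob : ∀ t < T, ∀ ω, ∀ Q ∈ Amb t ω, IsProbabilityMeasure Q
  moment : ∀ t < T, ∀ ω, ∀ Q ∈ Amb t ω,
    ∫⁻ x, edist x o ∂Q ≤ K t * (1 + pathDist ω (fun _ => o))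
  lipschitz : ∀ t < T, ∀ ω ω', ∀ Q ∈ Amb t ω, ∀ r : ℝ≥0, L t * pathDist ω ω' < r →
    ∃ Q' ∈ Amb t ω', wass 1 Q Q' ≤ r

/-- The worst-case expected continuation value of the action `b`. -/
def stepValue (Amb : (t : ℕ) → Hist X t → Set (Measure X)) (t : ℕ)
    (W : Hist X (t + 1) → ActionSeq m → ℝ) (ω : Hist X t) (a : ActionSeq m) (b : Euc (m t)) :
    ℝ :=
  ⨅ Q : Amb t ω, ∫ x, W (snocHist ω x) (Function.update a t b) ∂(Q : Measure X)

/-- The Bellman equations. -/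
def IsValueFunction (T : ℕ) (𝒜 : (t : ℕ) → Hist X t → Set (Euc (m t)))
    (Amb : (t : ℕ) → Hist X t → Set (Measure X)) (V : (t : ℕ) → Hist X t → ActionSeq m → ℝ) :
    Prop :=
  ∀ t < T, ∀ ω a, V t ω a = ⨆ b : 𝒜 t ω, stepValue Amb t (V (t + 1)) ω a b

/-- Backward iteration of the Bellman operator, `n` steps from time `t`, with terminal values
`g`. -/
def bellmanIter (𝒜 : (t : ℕ) → Hist X t → Set (Euc (m t)))
    (Amb : (t : ℕ) → Hist X t → Set (Measure X)) (g : (t : ℕ) → Hist X t → ActionSeq m → ℝ) :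
    (n t : ℕ) → Hist X t → ActionSeq m → ℝ
  | 0, t => g t
  | n + 1, t => fun ω a => ⨆ b : 𝒜 t ω, stepValue Amb t (bellmanIter 𝒜 Amb g n (t + 1)) ω a b

omit [MetricSpace X] in
theorem exists_isValueFunction (T : ℕ) (𝒜 : (t : ℕ) → Hist X t → Set (Euc (m t)))
    (Amb : (t : ℕ) → Hist X t → Set (Measure X)) (Ψ : Hist X T → Actions m T → ℝ) [Nonempty X] :
    ∃ V : (t : ℕ) → Hist X t → ActionSeq m → ℝ, IsValueFunction T 𝒜 Amb V ∧
      V T = fun ω a => Ψ ω (fun i => a i) := by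
  classical
  inhabit X
  -- Terminal values are needed for every length `t`, so short paths are padded. At `t = T` the
  -- padding disappears, and no cast along `t + (T - t) = T` is required.
  let g : (t : ℕ) → Hist X t → ActionSeq m → ℝ := fun t ω a =>
    Ψ (fun i => if h : i.1 < t then ω ⟨i, h⟩ else default) (fun i => a i)
  refine ⟨fun t => bellmanIter 𝒜 Amb g (T - t) t, fun t ht ω a => ?_, ?_⟩
  · have : T - t = (T - (t + 1)) + 1 := by omega
    change bellmanIter 𝒜 Amb g (T - t) t ω a = _
    rw [this]
    rfl
  · funext ω a
    simp [bellmanIter, g]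

variable [BorelSpace X] [SecondCountableTopology X]
  {T : ℕ} {𝒜 : (t : ℕ) → Hist X t → Set (Euc (m t))} {LA : ℕ → ℝ≥0}
  {Amb : (t : ℕ) → Hist X t → Set (Measure X)} {o : X} {K L : ℕ → ℝ≥0} {α : ℝ}
  {t : ℕ} {W : Hist X (t + 1) → ActionSeq m → ℝ} {H : ℝ≥0}

omit [MeasurableSpace X] [BorelSpace X] [SecondCountableTopology X] in
theorem IsHolderAt.isHolder_snoc (hα : 0 < α) (hW : IsHolderAt 𝒜 α (t + 1) W H)
    {ω : Hist X t} {a : ActionSeq m} {b : Euc (m t)} (ha : AdmissibleAt 𝒜 t ω a)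
    (hb : b ∈ 𝒜 t ω) : IsHolder (fun x => W (snocHist ω x) (Function.update a t b)) H α := by
  intro x y
  have h1 := hW _ _ _ _ (ha.snoc hb x) (ha.snoc hb y)
  have h2 := hW _ _ _ _ (ha.snoc hb y) (ha.snoc hb x)
  rw [holderCost_snoc, holderCost_self hα, dist_self, Real.zero_rpow hα.ne'] at h1 h2
  rw [dist_comm y x] at h2
  rw [abs_le]
  constructor <;> linarith

omit [BorelSpace X] [SecondCountableTopology X] in
theorem AmbiguityAssumption.moment_ne_top (hAmb : AmbiguityAssumption T Amb o K L) (ht : t < T)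
    {ω : Hist X t} {Q : Measure X} (hQ : Q ∈ Amb t ω) : ∫⁻ x, edist x o ∂Q ≠ ∞ := by
  refine ((hAmb.moment t ht ω Q hQ).trans_lt ?_).ne
  rw [pathDist_eq_coe]
  exact_mod_cast ENNReal.coe_lt_top

/-- The first moments are bounded uniformly over `Amb t ω` and a Hölder function has at most linear
growth. Without such a bound the real infimum in `stepValue` would take a junk value. -/
theorem IsHolder.bddBelow_integral (hα : 0 < α) (hα1 : α ≤ 1)
    (hAmb : AmbiguityAssumption T Amb o K L) (ht : t < T) {f : X → ℝ} (hf : IsHolder f H α)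
    (ω : Hist X t) : BddBelow (Set.range fun Q : Amb t ω => ∫ x, f x ∂(Q : Measure X)) := by
  set R : ℝ≥0 := K t * (1 + ∑ i, nndist (ω i) o) with hR
  refine ⟨f o - H * (1 + R), ?_⟩
  rintro _ ⟨⟨Q, hQ⟩, rfl⟩
  have := hAmb.prob t ht ω Q hQ
  have hfin := hAmb.moment_ne_top ht hQ
  have hd : ∫ x, dist x o ∂Q ≤ R := by
    rw [integral_eq_lintegral_of_nonneg_ae (.of_forall fun _ => dist_nonneg) (by fun_prop)]
    refine ENNReal.toReal_le_of_le_ofReal R.2 ?_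
    have := hAmb.moment t ht ω Q hQ
    rw [pathDist_eq_coe] at this
    simp only [← edist_dist, ENNReal.ofReal_coe_nnreal, hR]
    exact_mod_cast this
  have hi' : Integrable (fun x => 1 + dist x o) Q :=
    (integrable_const _).add (integrable_dist hfin)
  have hi : Integrable (fun x => f o - H * (1 + dist x o)) Q :=
    (integrable_const _).sub (hi'.const_mul _)
  calc f o - H * (1 + R) ≤ f o - H * (1 + ∫ x, dist x o ∂Q) := by gcongr
    _ = ∫ x, f o - H * (1 + dist x o) ∂Q := by
        rw [integral_sub (integrable_const _) (hi'.const_mul _),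
          integral_const_mul, integral_add (integrable_const _) (integrable_dist hfin)]
        simp
    _ ≤ ∫ x, f x ∂Q := by
        refine integral_mono hi (hf.integrable hα hα1 hfin) fun x => ?_
        have h1 := (abs_le.1 (hf x o)).1
        have h2 : (H : ℝ) * dist x o ^ α ≤ H * (1 + dist x o) :=
          mul_le_mul_of_nonneg_left (rpow_le_one_add dist_nonneg hα.le hα1) H.2
        change f o - H * (1 + dist x o) ≤ f x
        linarith

/-- Each `Q'` available at `ω'` has a nearby `Q` available at `ω`. The three costs come from
changing the history, the action and the measure. This one inequality yields continuity in the
action, the Hölder bound for the value, and closedness of the maximizers. -/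
theorem stepValue_le (hα : 0 < α) (hα1 : α ≤ 1) (hAmb : AmbiguityAssumption T Amb o K L)
    (ht : t < T) (hW : IsHolderAt 𝒜 α (t + 1) W H) {ω ω' : Hist X t} {a a' : ActionSeq m}
    {b b' : Euc (m t)} (ha : AdmissibleAt 𝒜 t ω a) (ha' : AdmissibleAt 𝒜 t ω' a')
    (hb : b ∈ 𝒜 t ω) (hb' : b' ∈ 𝒜 t ω') :
    stepValue Amb t W ω a b ≤ stepValue Amb t W ω' a' b' +
      H * (holderCost α t ω ω' a a' + dist b b' ^ α +
        (L t : ℝ) ^ α * holderCost α t ω ω' a a') := by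
  rw [← sub_le_iff_le_add]
  have := (hAmb.nonempty t ht ω').to_subtype
  refine le_ciInf fun ⟨Q', hQ'⟩ => ?_
  have hf := hW.isHolder_snoc hα ha hb
  have hf' := hW.isHolder_snoc hα ha' hb'
  have := hAmb.prob t ht ω' Q' hQ'
  set Δ : ℝ≥0 := L t * ∑ i, nndist (ω i) (ω' i) with hΔ
  -- A nearby measure is guaranteed only at radii strictly above `Δ`; the bound at `Δ` follows in
  -- the limit.
  have key : ∀ r : ℝ≥0, Δ < r → stepValue Amb t W ω a b -
      ∫ x, W (snocHist ω' x) (Function.update a' t b') ∂Q' ≤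
      H * (holderCost α t ω ω' a a' + dist b b' ^ α) + H * (r : ℝ) ^ α := by
    intro r hr
    obtain ⟨Q, hQ, hw⟩ := hAmb.lipschitz t ht ω' ω Q' hQ' r (by
      rw [pathDist_eq_coe]
      simp only [nndist_comm (ω' _)]
      exact_mod_cast hr)
    have := hAmb.prob t ht ω Q hQ
    have h1 : stepValue Amb t W ω a b ≤
        ∫ x, W (snocHist ω x) (Function.update a t b) ∂Q :=
      ciInf_le (hf.bddBelow_integral hα hα1 hAmb ht ω) ⟨Q, hQ⟩
    rw [wass_comm] at hw
    have h2 := integral_sub_le_of_wass_le hα hα1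
      (hf.integrable hα hα1 (hAmb.moment_ne_top ht hQ))
      (hf'.integrable hα hα1 (hAmb.moment_ne_top ht hQ'))
      (c := H * (holderCost α t ω ω' a a' + dist b b' ^ α)) (H := H) (fun x y => ?_) hw
    · linarith
    · have h := hW _ _ _ _ (ha.snoc hb x) (ha'.snoc hb' y)
      rw [holderCost_snoc] at h
      linarith
  have hcont : Continuous (fun s : ℝ≥0 =>
      H * (holderCost α t ω ω' a a' + dist b b' ^ α) + H * (s : ℝ) ^ α) :=
    continuous_const.add (continuous_const.mul
      (NNReal.continuous_coe.rpow_const fun _ => Or.inr hα.le))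
  have hlim := ge_of_tendsto ((hcont.tendsto Δ).mono_left
    (nhdsWithin_le_nhds (s := Set.Ioi Δ))) (Filter.eventually_of_mem self_mem_nhdsWithin key)
  have hΔle := mul_sum_nndist_rpow_le hα hα1 (L t) ω ω' a a'
  have : (H : ℝ) * (Δ : ℝ) ^ α ≤ H * ((L t : ℝ) ^ α * holderCost α t ω ω' a a') :=
    mul_le_mul_of_nonneg_left hΔle H.2
  simp only at hlim ⊢
  linarith

theorem continuousOn_stepValue (hα : 0 < α) (hα1 : α ≤ 1)
    (hAmb : AmbiguityAssumption T Amb o K L) (ht : t < T) (hW : IsHolderAt 𝒜 α (t + 1) W H)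
    {ω : Hist X t} {a : ActionSeq m} (ha : AdmissibleAt 𝒜 t ω a) :
    ContinuousOn (stepValue Amb t W ω a) (𝒜 t ω) := by
  intro b hb
  rw [ContinuousWithinAt, tendsto_iff_dist_tendsto_zero]
  have hlim : Filter.Tendsto (fun y => (H : ℝ) * dist y b ^ α) (nhdsWithin b (𝒜 t ω))
      (nhds 0) := by
    have : Continuous (fun y : Euc (m t) => (H : ℝ) * dist y b ^ α) :=
      continuous_const.mul
        ((continuous_id.dist continuous_const).rpow_const fun _ => Or.inr hα.le)
    simpa [Real.zero_rpow hα.ne'] using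
      (this.tendsto b).mono_left (nhdsWithin_le_nhds (s := 𝒜 t ω))
  refine squeeze_zero' (.of_forall fun _ => dist_nonneg)
    (Filter.eventually_of_mem self_mem_nhdsWithin fun y hy => ?_) hlim
  have h1 := stepValue_le hα hα1 hAmb ht hW ha ha hy hb
  have h2 := stepValue_le hα hα1 hAmb ht hW ha ha hb hy
  rw [holderCost_self hα] at h1 h2
  rw [dist_comm b y] at h2
  rw [Real.dist_eq, abs_le]
  constructor <;> linarith

variable {V : (t : ℕ) → Hist X t → ActionSeq m → ℝ}

theorem IsValueFunction.exists_isMax (hV : IsValueFunction T 𝒜 Amb V)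
    (hA : ControlAssumption T 𝒜 LA) (hα : 0 < α) (hα1 : α ≤ 1)
    (hAmb : AmbiguityAssumption T Amb o K L) (ht : t < T)
    (hW : IsHolderAt 𝒜 α (t + 1) (V (t + 1)) H)
    {ω : Hist X t} {a : ActionSeq m} (ha : AdmissibleAt 𝒜 t ω a) :
    ∃ b ∈ 𝒜 t ω, stepValue Amb t (V (t + 1)) ω a b = V t ω a ∧
      ∀ b' ∈ 𝒜 t ω, stepValue Amb t (V (t + 1)) ω a b' ≤ V t ω a := by
  obtain ⟨b, hb, hmax⟩ := (hA.compact t ht ω).exists_isMaxOn (hA.nonempty t ht ω)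
    (continuousOn_stepValue hα hα1 hAmb ht hW ha)
  have hub : ∀ b' ∈ 𝒜 t ω, stepValue Amb t (V (t + 1)) ω a b' ≤
      stepValue Amb t (V (t + 1)) ω a b := fun b' hb' => hmax hb'
  have hne := (hA.nonempty t ht ω).to_subtype
  have : V t ω a = stepValue Amb t (V (t + 1)) ω a b := by
    rw [hV t ht]
    refine le_antisymm (ciSup_le fun b' => hub b' b'.2) ?_
    refine le_ciSup (f := fun b : 𝒜 t ω => stepValue Amb t (V (t + 1)) ω a b) ?_ ⟨b, hb⟩
    exact ⟨_, by rintro _ ⟨b', rfl⟩; exact hub b' b'.2⟩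
  exact ⟨b, hb, this.symm, fun b' hb' => (hub b' hb').trans this.ge⟩

/-- One step of the backward propagation of Hölder constants. -/
theorem IsValueFunction.isHolderAt_step (hV : IsValueFunction T 𝒜 Amb V)
    (hA : ControlAssumption T 𝒜 LA) (hα : 0 < α) (hα1 : α ≤ 1)
    (hAmb : AmbiguityAssumption T Amb o K L) (ht : t < T)
    (hW : IsHolderAt 𝒜 α (t + 1) (V (t + 1)) H) :
    IsHolderAt 𝒜 α t (V t) (H * (2 * max (LA t ^ α + L t ^ α) 1)) := by
  intro ω ω' a a' ha ha'
  obtain ⟨b, hb, hbV, -⟩ := hV.exists_isMax hA hα hα1 hAmb ht hW ha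
  obtain ⟨-, -, -, hmax⟩ := hV.exists_isMax hA hα hα1 hAmb ht hW ha'
  obtain ⟨b', hb', hbb'⟩ := hA.lipschitz t ht ω ω' b hb
  have hd : dist b b' ^ α ≤ (LA t : ℝ) ^ α * holderCost α t ω ω' a a' := by
    refine le_trans ?_ (mul_sum_nndist_rpow_le hα hα1 (LA t) ω ω' a a')
    refine Real.rpow_le_rpow dist_nonneg ?_ hα.le
    rw [pathDist_eq_coe, edist_nndist] at hbb'
    rw [← coe_nndist]
    exact_mod_cast hbb'
  have h := stepValue_le hα hα1 hAmb ht hW ha ha' hb hb'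
  have h' := hmax b' hb'
  rw [hbV] at h
  set c := holderCost α t ω ω' a a' with hc
  have hc0 : 0 ≤ c := holderCost_nonneg _ _ _ _ _ _
  have hm1 : (1 : ℝ) ≤ max ((LA t : ℝ) ^ α + (L t : ℝ) ^ α) 1 := le_max_right _ _
  have hm2 : (LA t : ℝ) ^ α + (L t : ℝ) ^ α ≤ max ((LA t : ℝ) ^ α + (L t : ℝ) ^ α) 1 :=
    le_max_left _ _
  -- The bracket is at most `(1 + LA ^ α + L ^ α) * c`, and `1 + y ≤ 2 * max y 1`; this is the
  -- origin of the powers of 2 in `weight`.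
  have hfin : (H : ℝ) * (c + dist b b' ^ α + (L t : ℝ) ^ α * c) ≤
      H * ((2 * max ((LA t : ℝ) ^ α + (L t : ℝ) ^ α) 1) * c) := by
    refine mul_le_mul_of_nonneg_left ?_ H.2
    have := mul_le_mul_of_nonneg_right (add_le_add hm1 hm2) hc0
    linarith
  push_cast
  linarith

/-- The Hölder constant of the value function at time `t`. -/
def holderConst (T : ℕ) (α : ℝ) (LΨ : ℝ≥0) (LA L : ℕ → ℝ≥0) (t : ℕ) : ℝ≥0 :=
  LΨ * (2 ^ (T - t) * ∏ u ∈ Finset.Ico t T, max (LA u ^ α + L u ^ α) 1)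

theorem IsValueFunction.isHolderAt (hV : IsValueFunction T 𝒜 Amb V)
    (hA : ControlAssumption T 𝒜 LA) (hα : 0 < α) (hα1 : α ≤ 1)
    (hAmb : AmbiguityAssumption T Amb o K L) {LΨ : ℝ≥0} (hT : IsHolderAt 𝒜 α T (V T) LΨ) :
    ∀ t ≤ T, IsHolderAt 𝒜 α t (V t) (holderConst T α LΨ LA L t) := by
  intro t ht
  induction ht using Nat.decreasingInduction with
  | self => simpa [holderConst] using hT
  | of_succ t ht ih =>
    have h := hV.isHolderAt_step hA hα hα1 hAmb ht ih
    have : holderConst T α LΨ LA L t =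
        holderConst T α LΨ LA L (t + 1) * (2 * max (LA t ^ α + L t ^ α) 1) := by
      have h1 : T - t = (T - (t + 1)) + 1 := by omega
      rw [holderConst, holderConst, h1, pow_succ, Finset.prod_eq_prod_Ico_succ_bot ht]
      ring
    rw [this]
    exact h

end Bellman

/-! ### Optimal controls -/

section Controls

variable {X : Type} {m : ℕ → ℕ}

/-- The actions chosen by a control along a path up to time `t`. -/
def actionHistory (a : (t : ℕ) → Hist X t → Euc (m t)) : (t : ℕ) → Hist X t → ActionSeq m
  | 0, _ => 0
  | t + 1, ω => Function.update (actionHistory a t (Fin.init ω)) t (a t (Fin.init ω))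

theorem actionHistory_snoc (a : (t : ℕ) → Hist X t → Euc (m t)) {t : ℕ} (ω : Hist X t) (x : X) :
    actionHistory a (t + 1) (snocHist ω x) =
      Function.update (actionHistory a t ω) t (a t ω) := by
  rw [actionHistory, init_snocHist]

theorem actionHistory_apply (a : (t : ℕ) → Hist X t → Euc (m t)) {t i : ℕ} (hi : i < t)
    (ω : Hist X t) : actionHistory a t ω i = a i (initial hi.le ω) := by
  induction t with
  | zero => omega
  | succ t ih =>
    rw [actionHistory]
    rcases Nat.lt_succ_iff_lt_or_eq.1 hi with h | rfl
    · rw [Function.update_of_ne h.ne, ih h]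
      rfl
    · rw [Function.update_self]
      rfl

theorem admissibleAt_actionHistory {T : ℕ} {𝒜 : (t : ℕ) → Hist X t → Set (Euc (m t))}
    {a : (t : ℕ) → Hist X t → Euc (m t)} (ha : ∀ t < T, ∀ ω, a t ω ∈ 𝒜 t ω) {t : ℕ}
    (ht : t ≤ T) (ω : Hist X t) : AdmissibleAt 𝒜 t ω (actionHistory a t ω) := by
  intro i hi
  rw [actionHistory_apply a hi]
  exact ha i (hi.trans_le ht) _

variable [MeasurableSpace X]

theorem measurable_init {t : ℕ} :
    Measurable (fun ω : Hist X (t + 1) => (Fin.init ω : Hist X t)) :=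
  measurable_pi_lambda _ fun i => measurable_pi_apply i.castSucc

theorem measurable_snocHist {t : ℕ} :
    Measurable (fun z : Hist X t × X => snocHist z.1 z.2) := by
  refine measurable_pi_lambda _ fun i => ?_
  refine Fin.lastCases ?_ (fun i => ?_) i
  · simpa only [snocHist_last] using measurable_snd
  · simp only [snocHist_castSucc]
    exact (measurable_pi_apply i).comp measurable_fst

theorem measurable_update_action {Ω : Type*} [MeasurableSpace Ω] {t : ℕ}
    {f : Ω → ActionSeq m} {g : Ω → Euc (m t)} (hf : Measurable f) (hg : Measurable g) :
    Measurable (fun ω => Function.update (f ω) t (g ω)) := by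
  refine measurable_pi_lambda _ fun i => ?_
  rcases eq_or_ne i t with rfl | h
  · simpa only [Function.update_self] using hg
  · simp only [Function.update_of_ne h]
    exact (measurable_pi_apply i).comp hf

theorem measurable_actionHistory {T : ℕ} {a : (t : ℕ) → Hist X t → Euc (m t)}
    (ha : ∀ t < T, Measurable (a t)) : ∀ t ≤ T, Measurable (actionHistory a t) := by
  intro t
  induction t with
  | zero => exact fun _ => measurable_const
  | succ t ih =>
    intro ht
    exact measurable_update_action ((ih (by omega)).comp measurable_init)
      ((ha t ht).comp measurable_init)

end Controls

section Optimal

variable {X : Type} [MetricSpace X] {m : ℕ → ℕ}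
  {𝒜 : (t : ℕ) → Hist X t → Set (Euc (m t))} {α : ℝ} {t : ℕ} {H : ℝ≥0}

theorem IsHolderAt.continuous {W : Hist X t → ActionSeq m → ℝ} (hα : 0 < α)
    (hW : IsHolderAt 𝒜 α t W H) :
    Continuous (fun z : {z : Hist X t × ActionSeq m // AdmissibleAt 𝒜 t z.1 z.2} =>
      W z.1.1 z.1.2) := by
  rw [continuous_iff_continuousAt]
  intro z
  rw [ContinuousAt, tendsto_iff_dist_tendsto_zero]
  have hlim : Filter.Tendsto (fun y : {z : Hist X t × ActionSeq m // AdmissibleAt 𝒜 t z.1 z.2} =>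
      (H : ℝ) * holderCost α t y.1.1 z.1.1 y.1.2 z.1.2) (nhds z) (nhds 0) := by
    have := (((continuous_holderCost hα t z.1.1 z.1.2).comp
      continuous_subtype_val).tendsto z).const_mul (H : ℝ)
    simpa [holderCost_self hα] using this
  refine squeeze_zero (fun _ => dist_nonneg) (fun y => ?_) hlim
  have h1 := hW _ _ _ _ y.2 z.2
  have h2 := hW _ _ _ _ z.2 y.2
  rw [holderCost_comm] at h2
  rw [Real.dist_eq, abs_le]
  constructor <;> linarith

variable [MeasurableSpace X] [BorelSpace X] [SecondCountableTopology X]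
  {T : ℕ} {LA : ℕ → ℝ≥0} {Amb : (t : ℕ) → Hist X t → Set (Measure X)} {o : X}
  {K L : ℕ → ℝ≥0} {V : (t : ℕ) → Hist X t → ActionSeq m → ℝ}

/-- `W` is controlled only on admissible histories, so measurability comes from continuity on that
subtype. -/
theorem IsHolderAt.measurable_comp {W : Hist X t → ActionSeq m → ℝ} (hα : 0 < α)
    (hW : IsHolderAt 𝒜 α t W H) {f : Hist X t → ActionSeq m} (hf : Measurable f)
    (hadm : ∀ ω, AdmissibleAt 𝒜 t ω (f ω)) : Measurable (fun ω => W ω (f ω)) := by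
  have hm : Measurable (fun ω : Hist X t =>
      (⟨(ω, f ω), hadm ω⟩ : {z : Hist X t × ActionSeq m // AdmissibleAt 𝒜 t z.1 z.2})) :=
    (measurable_id.prodMk hf).subtype_mk
  exact (hW.continuous hα).measurable.comp hm

/-- A measurable selection of maximizers in the Bellman equation. -/
theorem IsValueFunction.exists_maximizer (hV : IsValueFunction T 𝒜 Amb V)
    (hA : ControlAssumption T 𝒜 LA) (hα : 0 < α) (hα1 : α ≤ 1)
    (hAmb : AmbiguityAssumption T Amb o K L) (ht : t < T) {H' : ℝ≥0}
    (hW : IsHolderAt 𝒜 α (t + 1) (V (t + 1)) H) (hVt : IsHolderAt 𝒜 α t (V t) H') :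
    ∃ s : {z : Hist X t × ActionSeq m // AdmissibleAt 𝒜 t z.1 z.2} → Euc (m t),
      Measurable s ∧ ∀ z, s z ∈ 𝒜 t z.1.1 ∧
        V t z.1.1 z.1.2 ≤ stepValue Amb t (V (t + 1)) z.1.1 z.1.2 (s z) := by
  have hM : IsMeasurableCorrespondence
      (fun z : {z : Hist X t × ActionSeq m // AdmissibleAt 𝒜 t z.1 z.2} =>
        {b ∈ 𝒜 t z.1.1 | V t z.1.1 z.1.2 ≤ stepValue Amb t (V (t + 1)) z.1.1 z.1.2 b}) := by
    refine ⟨fun z => ?_, fun z => ?_, fun C hC => IsClosed.measurableSet ?_⟩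
    · obtain ⟨b, hb, hbV, -⟩ := hV.exists_isMax hA hα hα1 hAmb ht hW z.2
      exact ⟨b, hb, hbV.ge⟩
    · have hc := hA.compact t ht z.1.1
      exact hc.of_isClosed_subset
        ((continuousOn_stepValue hα hα1 hAmb ht hW z.2).preimage_isClosed_of_isClosed
          hc.isClosed isClosed_Ici) (Set.sep_subset _ _)
    -- The constraint sets vary along the sequence. The Lipschitz condition moves the maximizers
    -- into the fixed compact set at the limit history, where a subsequence converges.
    · refine IsSeqClosed.isClosed fun z z₀ hz hlim => ?_
      choose b hb hbC using hz
      choose b' hb' hbb' using fun n => hA.lipschitz t ht (z n).1.1 z₀.1.1 (b n) (hb n).1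
      obtain ⟨b₀, hb₀, φ, hφ, hφlim⟩ := (hA.compact t ht z₀.1.1).tendsto_subseq hb'
      have hlim' : Filter.Tendsto (fun n => (z (φ n)).1) Filter.atTop (nhds z₀.1) :=
        (continuous_subtype_val.tendsto z₀).comp (hlim.comp hφ.tendsto_atTop)
      have hd0 : Filter.Tendsto (fun n => dist (b (φ n)) (b' (φ n))) Filter.atTop (nhds 0) := by
        have hsum : Filter.Tendsto
            (fun n => (LA t : ℝ) * ∑ i, dist ((z (φ n)).1.1 i) (z₀.1.1 i))
            Filter.atTop (nhds 0) := by
          have hc : Continuous (fun ω : Hist X t => (LA t : ℝ) * ∑ i, dist (ω i) (z₀.1.1 i)) := by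
            fun_prop
          simpa [Function.comp_def] using
            (hc.tendsto z₀.1.1).comp ((continuous_fst.tendsto z₀.1).comp hlim')
        refine squeeze_zero (fun _ => dist_nonneg) (fun n => ?_) hsum
        have h := hbb' (φ n)
        rw [pathDist_eq_coe, edist_nndist] at h
        have h' : nndist (b (φ n)) (b' (φ n)) ≤
            LA t * ∑ i, nndist ((z (φ n)).1.1 i) (z₀.1.1 i) := by exact_mod_cast h
        simpa [← NNReal.coe_le_coe] using h'
      have hblim : Filter.Tendsto (fun n => b (φ n)) Filter.atTop (nhds b₀) := by
        refine (tendsto_iff_of_dist ?_).2 hφlim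
        simpa [Function.comp_def] using hd0
      refine ⟨b₀, ⟨hb₀, ?_⟩, hC.mem_of_tendsto hblim (.of_forall fun n => hbC (φ n))⟩
      have hcost := (continuous_holderCost hα t z₀.1.1 z₀.1.2).tendsto z₀.1 |>.comp hlim'
      rw [holderCost_self hα] at hcost
      have hdist : Filter.Tendsto (fun n => dist (b (φ n)) b₀ ^ α) Filter.atTop (nhds 0) := by
        have hc : Continuous (fun y : Euc (m t) => dist y b₀ ^ α) :=
          (continuous_id.dist continuous_const).rpow_const fun _ => Or.inr hα.le
        simpa [Real.zero_rpow hα.ne', Function.comp_def] using (hc.tendsto b₀).comp hblim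
      -- Optimality passes to the limit through the chain: value at `z₀`, value at `z (φ n)`, step
      -- value of `b (φ n)`, step value of `b₀`. The two outer exchanges cost Hölder terms that
      -- vanish.
      have hrhs := (tendsto_const_nhds
        (x := stepValue Amb t (V (t + 1)) z₀.1.1 z₀.1.2 b₀)).add
        (((hcost.add hdist).add (hcost.const_mul ((L t : ℝ) ^ α))).const_mul (H : ℝ) |>.add
          (hcost.const_mul (H' : ℝ)))
      simp only [add_zero, mul_zero] at hrhs
      refine ge_of_tendsto hrhs (.of_forall fun n => ?_)
      have h1 := hVt _ _ _ _ z₀.2 (z (φ n)).2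
      have h2 := (hb (φ n)).2
      have h3 := stepValue_le hα hα1 hAmb ht hW (z (φ n)).2 z₀.2 (hb (φ n)).1 hb₀
      rw [holderCost_comm] at h1
      simp only [Function.comp_apply]
      linarith
  obtain ⟨s, hs, hsM⟩ := hM.exists_selection
  exact ⟨s, hs, hsM⟩

/-- A control that attains the maximum in all Bellman equations. -/
theorem IsValueFunction.exists_optimal_control (hV : IsValueFunction T 𝒜 Amb V)
    (hA : ControlAssumption T 𝒜 LA) (hα : 0 < α) (hα1 : α ≤ 1)
    (hAmb : AmbiguityAssumption T Amb o K L) {H : ℕ → ℝ≥0}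
    (hH : ∀ t ≤ T, IsHolderAt 𝒜 α t (V t) (H t)) :
    ∃ a ∈ controls T 𝒜, ∀ t < T, ∀ ω, V t ω (actionHistory a t ω) ≤
      stepValue Amb t (V (t + 1)) ω (actionHistory a t ω) (a t ω) := by
  classical
  have hsel : ∀ t, ∃ s : {z : Hist X t × ActionSeq m // AdmissibleAt 𝒜 t z.1 z.2} → Euc (m t),
      t < T → (Measurable s ∧ ∀ z, s z ∈ 𝒜 t z.1.1 ∧
        V t z.1.1 z.1.2 ≤ stepValue Amb t (V (t + 1)) z.1.1 z.1.2 (s z)) := by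
    intro t
    by_cases ht : t < T
    · obtain ⟨s, hs⟩ := hV.exists_maximizer hA hα hα1 hAmb ht (hH (t + 1) ht) (hH t ht.le)
      exact ⟨s, fun _ => hs⟩
    · exact ⟨fun _ => 0, fun h => absurd h ht⟩
  choose s hs using hsel
  -- The histories generated by the policy are known to be admissible only after an induction, so
  -- the selection is first extended by zero.
  let f : (t : ℕ) → Hist X t → ActionSeq m → Euc (m t) := fun t ω a =>
    if h : AdmissibleAt 𝒜 t ω a then s t ⟨(ω, a), h⟩ else 0
  let pol : (t : ℕ) → Hist X t → ActionSeq m := fun t =>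
    Nat.rec (motive := fun t => Hist X t → ActionSeq m) (fun _ => 0)
      (fun t p ω => Function.update (p (Fin.init ω)) t (f t (Fin.init ω) (p (Fin.init ω)))) t
  let a : (t : ℕ) → Hist X t → Euc (m t) := fun t ω => f t ω (pol t ω)
  have hpol : ∀ t, actionHistory a t = pol t := by
    intro t
    induction t with
    | zero => rfl
    | succ t ih =>
      funext ω
      rw [actionHistory, ih]
  have hstep : ∀ t < T, Measurable (pol t) → (∀ ω, AdmissibleAt 𝒜 t ω (pol t ω)) →
      Measurable (a t) ∧ ∀ ω, a t ω ∈ 𝒜 t ω ∧ V t ω (pol t ω) ≤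
        stepValue Amb t (V (t + 1)) ω (pol t ω) (a t ω) := by
    intro t ht hm hadm
    have ha : a t = fun ω => s t ⟨(ω, pol t ω), hadm ω⟩ := by
      funext ω
      exact dif_pos (hadm ω)
    rw [ha]
    exact ⟨(hs t ht).1.comp (measurable_id.prodMk hm).subtype_mk,
      fun ω => (hs t ht).2 ⟨(ω, pol t ω), hadm ω⟩⟩
  have hind : ∀ t ≤ T, Measurable (pol t) ∧ ∀ ω, AdmissibleAt 𝒜 t ω (pol t ω) := by
    intro t
    induction t with
    | zero => exact fun _ => ⟨measurable_const, fun ω i hi => absurd hi (by omega)⟩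
    | succ t ih =>
      intro ht
      obtain ⟨hm, hadm⟩ := ih (by omega)
      obtain ⟨h1, h2⟩ := hstep t ht hm hadm
      refine ⟨measurable_update_action (hm.comp measurable_init) (h1.comp measurable_init),
        fun ω => ?_⟩
      have h := (hadm (Fin.init ω)).snoc (h2 (Fin.init ω)).1 (ω (Fin.last t))
      rwa [snocHist, Fin.snoc_init_self] at h
  refine ⟨a, fun t ht => ?_, fun t ht ω => ?_⟩
  · obtain ⟨h1, h2⟩ := hstep t ht (hind t ht.le).1 (hind t ht.le).2
    exact ⟨h1, fun ω => (h2 ω).1⟩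
  · rw [hpol]
    exact ((hstep t ht (hind t ht.le).1 (hind t ht.le).2).2 ω).2

end Optimal

/-! ### Path laws and iterated expectations -/

section PathLaw

variable {X : Type} [MeasurableSpace X] (P : (t : ℕ) → Kernel (Hist X t) X)

theorem iterExp_mono {f g : (t : ℕ) → Hist X t → ℝ≥0∞} {s : ℕ} (h : ∀ ω, f s ω ≤ g s ω) :
    ∀ n t, t + n = s → ∀ ω, iterExp P f n t ω ≤ iterExp P g n t ω := by
  intro n
  induction n with
  | zero => rintro t rfl ω; exact h ω
  | succ n ih =>
    intro t ht ω
    exact lintegral_mono fun x => ih (t + 1) (by omega) _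

theorem iterExp_const_mul (c : ℕ → ℝ≥0) (f : (t : ℕ) → Hist X t → ℝ≥0∞) :
    ∀ n t ω, iterExp P (fun u ω => c u * f u ω) n t ω = c (t + n) * iterExp P f n t ω := by
  intro n
  induction n with
  | zero => exact fun t ω => rfl
  | succ n ih =>
    intro t ω
    simp only [iterExp, ih]
    rw [lintegral_const_mul' _ _ ENNReal.coe_ne_top, Nat.add_right_comm, Nat.add_assoc]

theorem iterExp_zero : ∀ n t ω, iterExp P (fun _ _ => 0) n t ω = 0 := by
  intro n
  induction n with
  | zero => exact fun t ω => rfl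
  | succ n ih => simp [iterExp, ih]

theorem iterExp_le_of_le [∀ t, IsMarkovKernel (P t)] {f : (t : ℕ) → Hist X t → ℝ≥0∞} {s : ℕ}
    {b : ℝ≥0∞} (h : ∀ ω, f s ω ≤ b) : ∀ n t, t + n = s → ∀ ω, iterExp P f n t ω ≤ b := by
  intro n
  induction n with
  | zero => rintro t rfl ω; exact h ω
  | succ n ih =>
    intro t ht ω
    calc ∫⁻ x, iterExp P f n (t + 1) (snocHist ω x) ∂(P t ω) ≤ ∫⁻ _, b ∂(P t ω) :=
          lintegral_mono fun x => ih (t + 1) (by omega) _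
      _ = b := by simp

variable [∀ t, IsMarkovKernel (P t)]

theorem measurable_iterExp {f : (t : ℕ) → Hist X t → ℝ≥0∞} (hf : ∀ t, Measurable (f t)) :
    ∀ n t, Measurable (iterExp P f n t) := by
  intro n
  induction n with
  | zero => exact hf
  | succ n ih =>
    intro t
    exact ((ih (t + 1)).comp measurable_snocHist).lintegral_kernel_prod_right' (κ := P t)

instance isProbabilityMeasure_pathLaw (t : ℕ) : IsProbabilityMeasure (pathLaw P t) := by
  induction t with
  | zero => rw [pathLaw]; infer_instance
  | succ t ih =>
    rw [pathLaw]
    exact Measure.isProbabilityMeasure_map measurable_snocHist.aemeasurable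

theorem lintegral_pathLaw_succ {t : ℕ} {h : Hist X (t + 1) → ℝ≥0∞} (hh : Measurable h) :
    ∫⁻ ω, h ω ∂(pathLaw P (t + 1)) = ∫⁻ ω, ∫⁻ x, h (snocHist ω x) ∂(P t ω) ∂(pathLaw P t) := by
  rw [pathLaw, lintegral_map hh measurable_snocHist,
    Measure.lintegral_compProd (f := fun z => h (snocHist z.1 z.2))
      (hh.comp measurable_snocHist)]

omit [∀ t, IsMarkovKernel (P t)] in
theorem integrable_pathLaw_succ {t : ℕ} {h : Hist X (t + 1) → ℝ}
    (hi : Integrable h (pathLaw P (t + 1))) :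
    Integrable (fun z : Hist X t × X => h (snocHist z.1 z.2)) (pathLaw P t ⊗ₘ P t) := by
  rw [pathLaw] at hi
  exact hi.comp_measurable measurable_snocHist

theorem integral_pathLaw_succ {t : ℕ} {h : Hist X (t + 1) → ℝ}
    (hi : Integrable h (pathLaw P (t + 1))) :
    ∫ ω, h ω ∂(pathLaw P (t + 1)) = ∫ ω, ∫ x, h (snocHist ω x) ∂(P t ω) ∂(pathLaw P t) := by
  have h' := integrable_pathLaw_succ P hi
  rw [pathLaw] at hi ⊢
  rw [integral_map measurable_snocHist.aemeasurable hi.1, Measure.integral_compProd h']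

theorem integrable_integral_pathLaw_succ {t : ℕ} {h : Hist X (t + 1) → ℝ}
    (hi : Integrable h (pathLaw P (t + 1))) :
    Integrable (fun ω => ∫ x, h (snocHist ω x) ∂(P t ω)) (pathLaw P t) :=
  Integrable.integral_compProd (κ := Kernel.const Unit (pathLaw P t))
    (η := Kernel.prodMkLeft Unit (P t)) (a := ()) (integrable_pathLaw_succ P hi)

theorem lintegral_iterExp {f : (t : ℕ) → Hist X t → ℝ≥0∞} (hf : ∀ t, Measurable (f t)) :
    ∀ n t, ∫⁻ ω, iterExp P f n t ω ∂(pathLaw P t) =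
      ∫⁻ ω, f (t + n) ω ∂(pathLaw P (t + n)) := by
  intro n
  induction n with
  | zero => exact fun t => rfl
  | succ n ih =>
    intro t
    have h := ih (t + 1)
    rw [lintegral_pathLaw_succ P (measurable_iterExp P hf n (t + 1))] at h
    have e : t + 1 + n = t + (n + 1) := by omega
    rw [e] at h
    exact h

/-- The bound `g` may be non-measurable, as for Wasserstein distances between kernels. The tower
property is therefore used only for the measurable `h`, and `g` enters by monotonicity of the lower
integral. -/
theorem lintegral_pathLaw_le_iterExp {s : ℕ} {h : Hist X s → ℝ≥0∞} (hh : Measurable h)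
    {g : (t : ℕ) → Hist X t → ℝ≥0∞} (hg : ∀ ω, h ω ≤ g s ω) :
    ∫⁻ ω, h ω ∂(pathLaw P s) ≤ iterExp P g s 0 Fin.elim0 := by
  let f : (t : ℕ) → Hist X t → ℝ≥0∞ := fun t ω => if e : t = s then h (e ▸ ω) else 0
  have hfs : f s = h := by funext ω; simp [f]
  have hf : ∀ t, Measurable (f t) := by
    intro t
    by_cases e : t = s
    · subst e; rw [hfs]; exact hh
    · simp only [f, e, dite_false]; exact measurable_const
  have h1 := lintegral_iterExp P hf s 0
  rw [pathLaw, lintegral_dirac' _ (measurable_iterExp P hf s 0), Nat.zero_add, hfs] at h1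
  rw [← h1]
  exact iterExp_mono P (by rw [hfs]; exact hg) s 0 (Nat.zero_add s) _

end PathLaw

/-- Discarding the negative part of `A - B` only increases its integral. -/
theorem integral_le_add_toReal {Ω : Type*} [MeasurableSpace Ω] {μ : Measure Ω} {A B : Ω → ℝ}
    (hA : Integrable A μ) (hB : Integrable B μ) {M : ℝ≥0∞} (hM : M ≠ ∞)
    (h : ∫⁻ ω, ENNReal.ofReal (A ω - B ω) ∂μ ≤ M) : ∫ ω, A ω ∂μ ≤ ∫ ω, B ω ∂μ + M.toReal := by
  have h1 := integral_eq_lintegral_pos_part_sub_lintegral_neg_part (hA.sub hB)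
  have h2 : ∫ ω, (A - B) ω ∂μ = ∫ ω, A ω ∂μ - ∫ ω, B ω ∂μ := integral_sub hA hB
  have h3 := ENNReal.toReal_mono hM h
  have h4 : 0 ≤ (∫⁻ ω, ENNReal.ofReal (-(A - B) ω) ∂μ).toReal := ENNReal.toReal_nonneg
  have h5 : (∫⁻ ω, ENNReal.ofReal ((A - B) ω) ∂μ).toReal =
    (∫⁻ ω, ENNReal.ofReal (A ω - B ω) ∂μ).toReal := rfl
  linarith

/-! ### Linear growth and integrability under path laws -/

section Moments

variable {X : Type} [MetricSpace X] {m : ℕ → ℕ}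

theorem pathDist_snoc_const {t : ℕ} (ω : Hist X t) (x o : X) :
    pathDist (snocHist ω x) (fun _ => o) = pathDist ω (fun _ => o) + edist x o := by
  rw [pathDist, Fin.sum_univ_castSucc, snocHist_last, pathDist]
  simp only [snocHist_castSucc]

theorem sum_nndist_initial_le {t i : ℕ} (h : i ≤ t) (ω : Hist X t) (o : X) :
    ∑ j, nndist (initial h ω j) o ≤ ∑ j, nndist (ω j) o := by
  have : ∑ j, nndist (initial h ω j) o =
      ∑ j ∈ Finset.univ.map (Fin.castLEEmb h), nndist (ω j) o := by
    rw [Finset.sum_map]; rfl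
  rw [this]
  exact Finset.sum_le_sum_of_subset (Finset.subset_univ _)

/-- Hölder functions on the admissible set have at most linear growth in the path. -/
theorem IsHolderAt.exists_growth {T : ℕ} {𝒜 : (t : ℕ) → Hist X t → Set (Euc (m t))}
    {LA : ℕ → ℝ≥0} (hA : ControlAssumption T 𝒜 LA) {α : ℝ} (hα : 0 < α) (hα1 : α ≤ 1) {t : ℕ}
    (ht : t ≤ T) {W : Hist X t → ActionSeq m → ℝ} {H : ℝ≥0} (hW : IsHolderAt 𝒜 α t W H)
    (o : X) : ∃ A B : ℝ≥0, ∀ ω a, AdmissibleAt 𝒜 t ω a →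
      |W ω a| ≤ A + B * ∑ i, dist (ω i) o := by
  classical
  -- The reference history stays at `o` and takes actions `a₀`; `R` bounds the compact action sets
  -- along it.
  have hex : ∀ i, ∃ a₀ : Euc (m i), ∃ R : ℝ≥0, i < T → a₀ ∈ 𝒜 i (fun _ => o) ∧
      ∀ a ∈ 𝒜 i (fun _ => o), dist a a₀ ≤ R := by
    intro i
    by_cases hi : i < T
    · obtain ⟨a₀, ha₀⟩ := hA.nonempty i hi (fun _ => o)
      obtain ⟨R, hR⟩ := (hA.compact i hi (fun _ => o)).isBounded.subset_closedBall a₀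
      exact ⟨a₀, R.toNNReal, fun _ => ⟨ha₀, fun a ha => (hR ha).trans (Real.le_coe_toNNReal R)⟩⟩
    · exact ⟨0, 0, fun h => absurd h hi⟩
  choose a₀ R ha₀ using hex
  have hadm : AdmissibleAt 𝒜 t (fun _ => o) a₀ := fun i hi => (ha₀ i (hi.trans_le ht)).1
  refine ⟨Real.nnabs (W (fun _ => o) a₀) + H * ∑ i : Fin t, (2 + R i),
    H * ∑ i : Fin t, (1 + LA i), fun ω a ha => ?_⟩
  have h1 := hW _ _ _ _ ha hadm
  have h2 := hW _ _ _ _ hadm ha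
  rw [holderCost_comm] at h2
  have hcost : holderCost α t ω (fun _ => o) a a₀ ≤
      ∑ i : Fin t, (2 + (R i : ℝ)) + (∑ i : Fin t, (1 + (LA i : ℝ))) * ∑ i, dist (ω i) o := by
    rw [Finset.sum_mul, ← Finset.sum_add_distrib, holderCost]
    refine Finset.sum_le_sum fun i _ => ?_
    have hiT := i.2.trans_le ht
    obtain ⟨a', ha', hd⟩ := hA.lipschitz i hiT _ (fun _ => o) _ (ha i i.2)
    rw [pathDist_eq_coe, edist_nndist] at hd
    have hd1 : nndist (a i) a' ≤ LA i * ∑ j, nndist (ω j) o := by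
      have : nndist (a i) a' ≤ LA i * ∑ j, nndist (initial i.2.le ω j) o := by exact_mod_cast hd
      exact this.trans (by gcongr; exact sum_nndist_initial_le i.2.le ω o)
    have hd2 : dist (a i) a' ≤ LA i * ∑ j, dist (ω j) o := by
      simpa [← NNReal.coe_le_coe] using hd1
    have hd3 := (ha₀ i hiT).2 a' ha'
    have hd4 := dist_triangle (a i) a' (a₀ i)
    have hd5 := rpow_le_one_add (dist_nonneg (x := a i) (y := a₀ i)) hα.le hα1
    have hd6 := rpow_le_one_add (dist_nonneg (x := ω i) (y := o)) hα.le hα1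
    have hd7 : dist (ω i) o ≤ ∑ j, dist (ω j) o :=
      Finset.single_le_sum (f := fun j => dist (ω j) o) (fun _ _ => dist_nonneg)
        (Finset.mem_univ i)
    linarith
  have hH := mul_le_mul_of_nonneg_left hcost H.2
  have h3 := abs_sub_abs_le_abs_sub (W ω a) (W (fun _ => o) a₀)
  have h4 : |W ω a - W (fun _ => o) a₀| ≤ H * holderCost α t ω (fun _ => o) a a₀ := by
    rw [abs_le]; constructor <;> linarith
  push_cast
  rw [mul_assoc]
  simp only [NNReal.val_eq_coe] at hH
  linarith

variable [MeasurableSpace X] [BorelSpace X] [SecondCountableTopology X]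
  (P : (t : ℕ) → Kernel (Hist X t) X) [∀ t, IsMarkovKernel (P t)]

omit [SecondCountableTopology X] in
theorem lintegral_pathDist_lt_top {T : ℕ} {o : X} {K : ℕ → ℝ≥0}
    (hP : ∀ t < T, ∀ ω, ∫⁻ x, edist x o ∂(P t ω) ≤ K t * (1 + pathDist ω (fun _ => o))) :
    ∀ t ≤ T, ∫⁻ ω, pathDist ω (fun _ => o) ∂(pathLaw P t) < ∞ := by
  have hm : ∀ t, Measurable (fun ω : Hist X t => pathDist ω (fun _ => o)) := by
    intro t; unfold pathDist; fun_prop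
  intro t
  induction t with
  | zero => intro _; simp [pathDist]
  | succ t ih =>
    intro ht
    rw [lintegral_pathLaw_succ P (hm _)]
    have hle : ∀ ω, ∫⁻ x, pathDist (snocHist ω x) (fun _ => o) ∂(P t ω) ≤
        pathDist ω (fun _ => o) + K t * (1 + pathDist ω (fun _ => o)) := by
      intro ω
      simp only [pathDist_snoc_const]
      rw [lintegral_add_left measurable_const]
      simpa using add_le_add_right (hP t ht ω) (pathDist ω (fun _ => o))
    refine (lintegral_mono hle).trans_lt ?_
    rw [lintegral_add_left (hm t), lintegral_const_mul' _ _ ENNReal.coe_ne_top,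
      lintegral_add_left measurable_const]
    have h := ih (by omega)
    refine ENNReal.add_lt_top.2 ⟨h, ENNReal.mul_lt_top ENNReal.coe_lt_top ?_⟩
    refine ENNReal.add_lt_top.2 ⟨by simp, h⟩

theorem IsHolderAt.integrable_pathLaw {T : ℕ} {𝒜 : (t : ℕ) → Hist X t → Set (Euc (m t))}
    {LA : ℕ → ℝ≥0} (hA : ControlAssumption T 𝒜 LA) {α : ℝ} (hα : 0 < α) (hα1 : α ≤ 1) {t : ℕ}
    (ht : t ≤ T) {W : Hist X t → ActionSeq m → ℝ} {H : ℝ≥0} (hW : IsHolderAt 𝒜 α t W H)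
    {o : X} {K : ℕ → ℝ≥0}
    (hP : ∀ t < T, ∀ ω, ∫⁻ x, edist x o ∂(P t ω) ≤ K t * (1 + pathDist ω (fun _ => o)))
    {a : (t : ℕ) → Hist X t → Euc (m t)} (ha : a ∈ controls T 𝒜) :
    Integrable (fun ω => W ω (actionHistory a t ω)) (pathLaw P t) := by
  obtain ⟨A, B, hAB⟩ := hW.exists_growth hA hα hα1 ht o
  have hadm := admissibleAt_actionHistory (fun t ht => (ha t ht).2) ht
  have hd : Integrable (fun ω : Hist X t => ∑ i, dist (ω i) o) (pathLaw P t) := by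
    refine ⟨Measurable.aestronglyMeasurable (by fun_prop), ?_⟩
    have h := lintegral_pathDist_lt_top P hP t ht
    refine lt_of_eq_of_lt (lintegral_congr fun ω => ?_) h
    rw [Real.enorm_eq_ofReal (Finset.sum_nonneg fun _ _ => dist_nonneg),
      ENNReal.ofReal_sum_of_nonneg fun _ _ => dist_nonneg, pathDist]
    simp only [edist_dist]
  refine ((integrable_const (A : ℝ)).add (hd.const_mul (B : ℝ))).mono'
    (hW.measurable_comp hα (measurable_actionHistory (fun t ht => (ha t ht).1) t ht)
      hadm).aestronglyMeasurable (.of_forall fun ω => hAB _ _ (hadm ω))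

end Moments

/-! ### Comparison of expected payoffs with the value function -/

section Comparison

variable {X : Type} [MetricSpace X] [MeasurableSpace X] [BorelSpace X]
  [SecondCountableTopology X] {m : ℕ → ℕ} {T : ℕ} {𝒜 : (t : ℕ) → Hist X t → Set (Euc (m t))}
  {LA : ℕ → ℝ≥0} {Amb : (t : ℕ) → Hist X t → Set (Measure X)} {o : X} {K L K' : ℕ → ℝ≥0}
  {α : ℝ} {V : (t : ℕ) → Hist X t → ActionSeq m → ℝ} {H : ℕ → ℝ≥0}
  (P : (t : ℕ) → Kernel (Hist X t) X) [∀ t, IsMarkovKernel (P t)]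

/-- Telescoping: the action `a t` is at best optimal, so `V t` dominates its step value, an infimum
over `Q`. Hence `g` has to control every `Q` in the ambiguity set. -/
theorem integral_value_le_add_sum (hV : IsValueFunction T 𝒜 Amb V)
    (hA : ControlAssumption T 𝒜 LA) (hα : 0 < α) (hα1 : α ≤ 1)
    (hAmb : AmbiguityAssumption T Amb o K L) (hH : ∀ t ≤ T, IsHolderAt 𝒜 α t (V t) (H t))
    (hP : ∀ t < T, ∀ ω, ∫⁻ x, edist x o ∂(P t ω) ≤ K' t * (1 + pathDist ω (fun _ => o)))
    {a : (t : ℕ) → Hist X t → Euc (m t)} (ha : a ∈ controls T 𝒜)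
    {g : (t : ℕ) → Hist X t → ℝ≥0∞}
    (hg : ∀ t < T, ∀ ω, ∀ f : X → ℝ, IsHolder f (H (t + 1)) α → ∀ Q ∈ Amb t ω,
      ENNReal.ofReal (∫ x, f x ∂(P t ω) - ∫ x, f x ∂Q) ≤ g t ω)
    (hfin : ∀ s < T, iterExp P g s 0 Fin.elim0 ≠ ∞) :
    ∀ t ≤ T, ∫ ω, V t ω (actionHistory a t ω) ∂(pathLaw P t) ≤
      V 0 Fin.elim0 0 + ∑ s ∈ Finset.range t, (iterExp P g s 0 Fin.elim0).toReal := by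
  have hint := fun t ht => (hH t ht).integrable_pathLaw P hA hα hα1 ht hP ha
  have hadm := fun t ht => admissibleAt_actionHistory (t := t) (fun t ht => (ha t ht).2) ht
  have hmeas := fun t ht => (hH t ht).measurable_comp hα
    (measurable_actionHistory (fun t ht => (ha t ht).1) t ht) (hadm t ht)
  intro t
  induction t with
  | zero =>
    intro ht
    rw [pathLaw, integral_dirac' _ _ (hmeas 0 ht).stronglyMeasurable]
    simp [actionHistory]
  | succ t ih =>
    intro ht
    have ht' : t < T := ht
    rw [integral_pathLaw_succ P (hint _ ht), Finset.sum_range_succ]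
    have hB := integrable_integral_pathLaw_succ P (hint _ ht)
    have hBm : Measurable fun ω => ∫ x, V (t + 1) (snocHist ω x)
        (actionHistory a (t + 1) (snocHist ω x)) ∂(P t ω) :=
      (((hmeas _ ht).comp measurable_snocHist).stronglyMeasurable.integral_kernel_prod_right'
        (κ := P t)).measurable
    have hstep := integral_le_add_toReal hB (hint t ht'.le) (hfin t ht') (by
      refine lintegral_pathLaw_le_iterExp P
        (hBm.sub (hmeas t ht'.le)).ennreal_ofReal fun ω => ?_
      have hb := (ha t ht').2 ω
      have hf := (hH _ ht).isHolder_snoc hα (hadm t ht'.le ω) hb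
      simp only [actionHistory_snoc]
      -- An infinite error is harmless pointwise; only its iterated expectation is assumed finite.
      rcases eq_or_ne (g t ω) ∞ with htop | htop
      · rw [htop]; exact le_top
      refine ENNReal.ofReal_le_of_le_toReal ?_
      have hne := (hAmb.nonempty t ht' ω).to_subtype
      obtain ⟨-, -, -, hmax⟩ := hV.exists_isMax hA hα hα1 hAmb ht' (hH _ ht) (hadm t ht'.le ω)
      have h1 := hmax _ hb
      have h2 : ∫ x, V (t + 1) (snocHist ω x)
          (Function.update (actionHistory a t ω) t (a t ω)) ∂(P t ω) - (g t ω).toReal ≤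
          stepValue Amb t (V (t + 1)) ω (actionHistory a t ω) (a t ω) := by
        refine le_ciInf fun Q => ?_
        have := (ENNReal.ofReal_le_iff_le_toReal htop).1 (hg t ht' ω _ hf Q Q.2)
        linarith
      simp only [Pi.sub_apply]
      linarith)
    linarith [ih ht'.le]

/-- Telescoping in the other direction: the control attains the Bellman maximum, and the infimum in
its step value is bounded by the integral under any single `Q`. -/
theorem le_integral_value_add_sum (hα : 0 < α) (hα1 : α ≤ 1) (hA : ControlAssumption T 𝒜 LA)
    (hAmb : AmbiguityAssumption T Amb o K L) (hH : ∀ t ≤ T, IsHolderAt 𝒜 α t (V t) (H t))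
    (hP : ∀ t < T, ∀ ω, ∫⁻ x, edist x o ∂(P t ω) ≤ K' t * (1 + pathDist ω (fun _ => o)))
    {a : (t : ℕ) → Hist X t → Euc (m t)} (ha : a ∈ controls T 𝒜)
    (hopt : ∀ t < T, ∀ ω, V t ω (actionHistory a t ω) ≤
      stepValue Amb t (V (t + 1)) ω (actionHistory a t ω) (a t ω))
    {g : (t : ℕ) → Hist X t → ℝ≥0∞}
    (hg : ∀ t < T, ∀ ω, ∃ Q ∈ Amb t ω, ∀ f : X → ℝ, IsHolder f (H (t + 1)) α →
      ENNReal.ofReal (∫ x, f x ∂Q - ∫ x, f x ∂(P t ω)) ≤ g t ω)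
    (hfin : ∀ s < T, iterExp P g s 0 Fin.elim0 ≠ ∞) :
    ∀ t ≤ T, V 0 Fin.elim0 0 ≤ ∫ ω, V t ω (actionHistory a t ω) ∂(pathLaw P t) +
      ∑ s ∈ Finset.range t, (iterExp P g s 0 Fin.elim0).toReal := by
  have hint := fun t ht => (hH t ht).integrable_pathLaw P hA hα hα1 ht hP ha
  have hadm := fun t ht => admissibleAt_actionHistory (t := t) (fun t ht => (ha t ht).2) ht
  have hmeas := fun t ht => (hH t ht).measurable_comp hα
    (measurable_actionHistory (fun t ht => (ha t ht).1) t ht) (hadm t ht)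
  intro t
  induction t with
  | zero =>
    intro ht
    rw [pathLaw, integral_dirac' _ _ (hmeas 0 ht).stronglyMeasurable]
    simp [actionHistory]
  | succ t ih =>
    intro ht
    have ht' : t < T := ht
    rw [integral_pathLaw_succ P (hint _ ht), Finset.sum_range_succ]
    have hB := integrable_integral_pathLaw_succ P (hint _ ht)
    have hBm : Measurable fun ω => ∫ x, V (t + 1) (snocHist ω x)
        (actionHistory a (t + 1) (snocHist ω x)) ∂(P t ω) :=
      (((hmeas _ ht).comp measurable_snocHist).stronglyMeasurable.integral_kernel_prod_right'
        (κ := P t)).measurable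
    have hstep := integral_le_add_toReal (hint t ht'.le) hB (hfin t ht') (by
      refine lintegral_pathLaw_le_iterExp P
        ((hmeas t ht'.le).sub hBm).ennreal_ofReal fun ω => ?_
      have hf := (hH _ ht).isHolder_snoc hα (hadm t ht'.le ω) ((ha t ht').2 ω)
      obtain ⟨Q, hQ, hQg⟩ := hg t ht' ω
      simp only [actionHistory_snoc]
      refine le_trans (ENNReal.ofReal_le_ofReal ?_) (hQg _ hf)
      have h1 : stepValue Amb t (V (t + 1)) ω (actionHistory a t ω) (a t ω) ≤ _ :=
        ciInf_le (hf.bddBelow_integral hα hα1 hAmb ht' ω) ⟨Q, hQ⟩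
      have h2 := hopt t ht' ω
      simp only [Pi.sub_apply]
      linarith)
    linarith [ih ht'.le]

end Comparison

/-! ### Values of the control problems -/

section Terminal

variable {d : ℕ} {S : Set (Euc d)} {T : ℕ} {m : ℕ → ℕ}
  {𝒜 : (t : ℕ) → Hist S t → Set (Euc (m t))} {Ψ : Hist S T → Actions m T → ℝ} {p : ℕ} {α : ℝ}
  {LΨ : ℝ≥0}

theorem UtilityAssumption.isHolderAt (hΨ : UtilityAssumption 𝒜 Ψ p α LΨ) :
    IsHolderAt 𝒜 α T (fun ω (a : ActionSeq m) => Ψ ω (fun i => a i)) LΨ := by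
  intro ω ω' a a' ha ha'
  have h := (abs_le.1 (hΨ.holder (ω, fun i => a i) (fun i => ha i i.2)
    (ω', fun i => a' i) (fun i => ha' i i.2))).2
  rw [holderCost]
  simp only at h
  linarith

theorem payoff_eq (a : (t : ℕ) → Hist S t → Euc (m t)) (ω : Hist S T) :
    payoff Ψ a ω = Ψ ω (fun i => actionHistory a T ω i) := by
  rw [payoff]
  congr 1
  funext i
  exact (actionHistory_apply a i.2 ω).symm

variable {LA : ℕ → ℝ≥0} {o : S} {K L : ℕ → ℝ≥0}

theorem UtilityAssumption.integrable_payoff (hΨ : UtilityAssumption 𝒜 Ψ p α LΨ)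
    (hA : ControlAssumption T 𝒜 LA) (P : (t : ℕ) → Kernel (Hist S t) S)
    [∀ t, IsMarkovKernel (P t)]
    (hP : ∀ t < T, ∀ ω, ∫⁻ x, edist x o ∂(P t ω) ≤ K t * (1 + pathDist ω (fun _ => o)))
    {a : (t : ℕ) → Hist S t → Euc (m t)} (ha : a ∈ controls T 𝒜) :
    Integrable (payoff Ψ a) (pathLaw P T) := by
  refine (hΨ.isHolderAt.integrable_pathLaw P hA hΨ.exponent_pos hΨ.exponent_le le_rfl hP
    ha).congr (.of_forall fun ω => ?_)
  exact (payoff_eq a ω).symm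

/-- The value `v` of the dynamic programme compares with expected payoffs under path laws. -/
theorem UtilityAssumption.exists_dynamic_value (hΨ : UtilityAssumption 𝒜 Ψ p α LΨ)
    (hA : ControlAssumption T 𝒜 LA) {Amb : (t : ℕ) → Hist S t → Set (Measure S)}
    (hAmb : AmbiguityAssumption T Amb o K L) :
    ∃ v : ℝ, (∀ (P : (t : ℕ) → Kernel (Hist S t) S), (∀ t, IsMarkovKernel (P t)) →
        ∀ K' : ℕ → ℝ≥0,
        (∀ t < T, ∀ ω, ∫⁻ x, edist x o ∂(P t ω) ≤ K' t * (1 + pathDist ω (fun _ => o))) →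
        ∀ g : (t : ℕ) → Hist S t → ℝ≥0∞,
        (∀ t < T, ∀ ω, ∀ f : S → ℝ, IsHolder f (LΨ * weight T α LA L t) α → ∀ Q ∈ Amb t ω,
          ENNReal.ofReal (∫ x, f x ∂(P t ω) - ∫ x, f x ∂Q) ≤ g t ω) →
        (∀ s < T, iterExp P g s 0 Fin.elim0 ≠ ∞) → ∀ a ∈ controls T 𝒜,
        ∫ ω, payoff Ψ a ω ∂(pathLaw P T) ≤
          v + ∑ s ∈ Finset.range T, (iterExp P g s 0 Fin.elim0).toReal) ∧
      ∃ a ∈ controls T 𝒜, ∀ (P : (t : ℕ) → Kernel (Hist S t) S),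
        (∀ t, IsMarkovKernel (P t)) → ∀ K' : ℕ → ℝ≥0,
        (∀ t < T, ∀ ω, ∫⁻ x, edist x o ∂(P t ω) ≤ K' t * (1 + pathDist ω (fun _ => o))) →
        ∀ g : (t : ℕ) → Hist S t → ℝ≥0∞,
        (∀ t < T, ∀ ω, ∃ Q ∈ Amb t ω, ∀ f : S → ℝ, IsHolder f (LΨ * weight T α LA L t) α →
          ENNReal.ofReal (∫ x, f x ∂Q - ∫ x, f x ∂(P t ω)) ≤ g t ω) →
        (∀ s < T, iterExp P g s 0 Fin.elim0 ≠ ∞) →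
        v ≤ ∫ ω, payoff Ψ a ω ∂(pathLaw P T) +
          ∑ s ∈ Finset.range T, (iterExp P g s 0 Fin.elim0).toReal := by
  have hα := hΨ.exponent_pos
  have hα1 := hΨ.exponent_le
  have : Nonempty S := ⟨o⟩
  obtain ⟨V, hV, hVT⟩ := exists_isValueFunction T 𝒜 Amb Ψ
  have hH := hV.isHolderAt hA hα hα1 hAmb (LΨ := LΨ) (by rw [hVT]; exact hΨ.isHolderAt)
  have hpay : ∀ a ω, payoff Ψ a ω = V T ω (actionHistory a T ω) := by
    intro a ω
    rw [payoff_eq, hVT]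
  refine ⟨V 0 Fin.elim0 0, fun P hPm K' hP g hg hfin a ha => ?_, ?_⟩
  · simp only [hpay]
    -- `holderConst` at time `t + 1` unfolds to `LΨ * weight T α LA L t`, the constant in the
    -- hypothesis on `g`.
    exact integral_value_le_add_sum P hV hA hα hα1 hAmb hH hP ha hg hfin T le_rfl
  · obtain ⟨a, ha, hopt⟩ := hV.exists_optimal_control hA hα hα1 hAmb hH
    refine ⟨a, ha, fun P hPm K' hP g hg hfin => ?_⟩
    simp only [hpay]
    exact le_integral_value_add_sum P hα hα1 hA hAmb hH hP ha hopt hg hfin T le_rfl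

end Terminal

/-! ### One-step errors and their iterated expectations -/

section Bounds

variable {X : Type} [MetricSpace X] [MeasurableSpace X]

theorem IsHolder.ofReal_integral_sub_le [BorelSpace X] [SecondCountableTopology X] {f : X → ℝ}
    {H r : ℝ≥0} {α : ℝ} (hα : 0 < α) (hα1 : α ≤ 1)
    (hf : IsHolder f H α) {μ ν : Measure X} [IsProbabilityMeasure μ] [IsProbabilityMeasure ν]
    {o : X} (hμ : ∫⁻ x, edist x o ∂μ ≠ ∞) (hν : ∫⁻ x, edist x o ∂ν ≠ ∞)
    (hr : wass 1 μ ν ≤ r) :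
    ENNReal.ofReal (∫ x, f x ∂μ - ∫ x, f x ∂ν) ≤ H * (r : ℝ≥0∞) ^ α := by
  refine (ENNReal.ofReal_le_ofReal (hf.integral_sub_le hα hα1 hμ hν hr)).trans_eq ?_
  rw [ENNReal.ofReal_mul (NNReal.coe_nonneg H), ← ENNReal.coe_rpow_of_nonneg _ hα.le,
    ← NNReal.coe_rpow, ENNReal.ofReal_coe_nnreal, ENNReal.ofReal_coe_nnreal]

omit [MetricSpace X] in
theorem iterExp_const_mul_eq (P : (t : ℕ) → Kernel (Hist X t) X) (c : ℕ → ℝ≥0) (α : ℝ)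
    (f : (t : ℕ) → Hist X t → ℝ≥0∞) (s : ℕ) :
    iterExp P (fun u ω => c u * f u ω ^ α) s 0 Fin.elim0 =
      c s * muNested P α f s 0 Fin.elim0 := by
  rw [iterExp_const_mul P c (fun u ω => f u ω ^ α), Nat.zero_add]
  rfl

theorem AmbiguityAssumption.ambiguityLaws_moment {T : ℕ}
    {Amb : (t : ℕ) → Hist X t → Set (Measure X)} {o : X} {K L : ℕ → ℝ≥0}
    (hAmb : AmbiguityAssumption T Amb o K L) {P : (t : ℕ) → Kernel (Hist X t) X}
    (hP : ∀ t < T, ∀ ω, P t ω ∈ Amb t ω) :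
    ∀ t < T, ∀ ω, ∫⁻ x, edist x o ∂(P t ω) ≤ K t * (1 + pathDist ω (fun _ => o)) :=
  fun t ht ω => hAmb.moment t ht ω _ (hP t ht ω)

omit [MeasurableSpace X] in
theorem momentBound_ne_top {t : ℕ} (k : ℝ≥0) (ω ω' : Hist X t) :
    (k : ℝ≥0∞) * (1 + pathDist ω ω') ≠ ∞ := by
  rw [pathDist_eq_coe]
  exact_mod_cast ENNReal.coe_ne_top

end Bounds

/-! ### Bounds for values in the extended reals -/

section Values

variable {X : Type} [MeasurableSpace X] {T : ℕ} {m : ℕ → ℕ}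
  {𝒜 : (t : ℕ) → Hist X t → Set (Euc (m t))} {Ψ : Hist X T → Actions m T → ℝ}

theorem value_le {μ : Measure (Hist X T)} {c : ℝ}
    (h : ∀ a ∈ controls T 𝒜, ∫ ω, payoff Ψ a ω ∂μ ≤ c) : value 𝒜 Ψ μ ≤ c :=
  iSup₂_le fun a ha => EReal.coe_le_coe_iff.2 (h a ha)

theorem le_value {μ : Measure (Hist X T)} {c : ℝ} {a : (t : ℕ) → Hist X t → Euc (m t)}
    (ha : a ∈ controls T 𝒜) (h : c ≤ ∫ ω, payoff Ψ a ω ∂μ) : (c : EReal) ≤ value 𝒜 Ψ μ :=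
  le_iSup₂_of_le a ha (EReal.coe_le_coe_iff.2 h)

theorem le_robustValue {M : Set (Measure (Hist X T))} {c : ℝ}
    {a : (t : ℕ) → Hist X t → Euc (m t)} (ha : a ∈ controls T 𝒜)
    (h : ∀ μ ∈ M, c ≤ ∫ ω, payoff Ψ a ω ∂μ) : (c : EReal) ≤ robustValue 𝒜 Ψ M :=
  le_iSup₂_of_le a ha (le_iInf₂ fun μ hμ => EReal.coe_le_coe_iff.2 (h μ hμ))

theorem robustValue_le_value {M : Set (Measure (Hist X T))} {μ : Measure (Hist X T)}
    (hμ : μ ∈ M) : robustValue 𝒜 Ψ M ≤ value 𝒜 Ψ μ :=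
  iSup₂_mono fun _ _ => iInf₂_le μ hμ

/-- The values are shown to be finite by enclosing them between real numbers. -/
theorem exists_coe_eq_of_le_of_le {x : EReal} {a b : ℝ} (ha : (a : EReal) ≤ x)
    (hb : x ≤ (b : EReal)) : ∃ y : ℝ, x = y ∧ a ≤ y ∧ y ≤ b := by
  have h1 : x ≠ ⊥ := fun h => by simp [h] at ha
  have h2 : x ≠ ⊤ := fun h => by simp [h] at hb
  lift x to ℝ using ⟨h2, h1⟩
  exact ⟨x, rfl, EReal.coe_le_coe_iff.1 ha, EReal.coe_le_coe_iff.1 hb⟩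

theorem EReal_coe_le_coe_ennreal {x : ℝ} {B : ℝ≥0∞} (hB : B ≠ ∞) (h : x ≤ B.toReal) :
    (x : EReal) ≤ (B : EReal) := by
  lift B to ℝ≥0 using hB
  exact EReal.coe_le_coe_iff.2 h

end Values

/-! ### First-moment bounds for kernels -/

section Moments

variable {d : ℕ} {S : Set (Euc d)} {T : ℕ}

/-- Compare with the kernel at the constant path `o`: its first moment is finite and the Lipschitz
bound adds a term linear in the path. -/
theorem LipschitzKernels.exists_moment {r q : ℕ} (hr : 1 ≤ r) (hq : 1 ≤ q)
    {P : (t : ℕ) → Kernel (Hist S t) S} {L : ℕ → ℝ≥0} (hP : LipschitzKernels T r q P L) (o : S) :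
    ∃ K : ℕ → ℝ≥0, ∀ t < T, ∀ ω,
      ∫⁻ x, edist x o ∂(P t ω) ≤ K t * (1 + pathDist ω (fun _ => o)) := by
  refine ⟨fun t => (∫⁻ x, edist x o ∂(P t (fun _ => o))).toNNReal + L t, fun t ht ω => ?_⟩
  have hm := hP.moment t ht
  have := (hm (fun _ => o)).1
  have hfin := lintegral_edist_ne_top_of_mem_momentMeasures hr (hm (fun _ => o)) o
  have hw := (wass_one_le hq (P t (fun _ => o)) (P t ω)).trans (hP.lipschitz t ht _ ω)
  have hsymm : pathDist (fun _ => o) ω = pathDist ω (fun _ => o) := by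
    simp [pathDist, edist_comm]
  rw [hsymm] at hw
  refine (lintegral_edist_le_add_wass (P t (fun _ => o)) (P t ω) o).trans ?_
  rw [ENNReal.coe_add, ENNReal.coe_toNNReal hfin, add_mul]
  refine add_le_add (le_mul_of_one_le_right' le_self_add) (hw.trans ?_)
  gcongr
  exact le_add_self

theorem moment_le_of_wass_le {o : S} {μ ν : Measure S} {k b : ℝ≥0} {t : ℕ} {ω : Hist S t}
    (hμ : ∫⁻ x, edist x o ∂μ ≤ k * (1 + pathDist ω (fun _ => o))) (h : wass 1 μ ν ≤ b) :
    ∫⁻ x, edist x o ∂ν ≤ ((k + b : ℝ≥0) : ℝ≥0∞) * (1 + pathDist ω (fun _ => o)) := by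
  refine (lintegral_edist_le_add_wass μ ν o).trans ?_
  rw [ENNReal.coe_add, add_mul]
  exact add_le_add hμ (h.trans (le_mul_of_one_le_right' le_self_add))

end Moments

/-! ### The stability and robustness bounds -/

section Main

variable {d : ℕ} {S : Set (Euc d)} {T : ℕ} {m : ℕ → ℕ}
  {𝒜 : (t : ℕ) → Hist S t → Set (Euc (m t))} {Ψ : Hist S T → Actions m T → ℝ} {p : ℕ} {α : ℝ}
  {LΨ : ℝ≥0} {LA : ℕ → ℝ≥0} {o : S} {K L : ℕ → ℝ≥0}
  (Ptr Phat : (t : ℕ) → Kernel (Hist S t) S)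
  [∀ t, IsMarkovKernel (Ptr t)] [∀ t, IsMarkovKernel (Phat t)]

theorem sum_toReal_iterExp (P : (t : ℕ) → Kernel (Hist S t) S) (c : ℕ → ℝ≥0)
    (f : (t : ℕ) → Hist S t → ℝ≥0∞) (hfin : ∀ s < T, muNested P α f s 0 Fin.elim0 ≠ ∞) :
    ∑ s ∈ Finset.range T, (iterExp P (fun u ω => c u * f u ω ^ α) s 0 Fin.elim0).toReal =
      (∑ s ∈ Finset.range T, c s * muNested P α f s 0 Fin.elim0).toReal := by
  rw [ENNReal.toReal_sum fun s hs =>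
    ENNReal.mul_ne_top ENNReal.coe_ne_top (hfin s (Finset.mem_range.1 hs))]
  simp only [iterExp_const_mul_eq]

/-- The dynamic programme is that of the reference model and is tested under the true law. Hence the
weights carry the Lipschitz constants of `Phat`, while the errors are averaged under `Ptr`. -/
theorem stability_bound (hA : ControlAssumption T 𝒜 LA) (hΨ : UtilityAssumption 𝒜 Ψ p α LΨ)
    (o : S) {r : ℕ} (hr : 1 ≤ r) {LPtr LPhat : ℕ → ℝ≥0}
    (htr : LipschitzKernels T r 1 Ptr LPtr) (hhat : LipschitzKernels T r 1 Phat LPhat)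
    (hfin : ∀ s < T, ∀ t ≤ s, ∀ ω,
      muNested Ptr α (fun u ω => wass 1 (Ptr u ω) (Phat u ω)) s t ω < ∞) :
    (∀ a ∈ controls T 𝒜, Integrable (payoff Ψ a) (pathLaw Ptr T) ∧
      Integrable (payoff Ψ a) (pathLaw Phat T)) ∧
    (value 𝒜 Ψ (pathLaw Ptr T) - value 𝒜 Ψ (pathLaw Phat T)).abs ≤
      ∑ s ∈ Finset.range T, ((LΨ * weight T α LA LPhat s : ℝ≥0) : ℝ≥0∞) *
        muNested Ptr α (fun u ω => wass 1 (Ptr u ω) (Phat u ω)) s 0 Fin.elim0 := by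
  have hα := hΨ.exponent_pos
  have hα1 := hΨ.exponent_le
  obtain ⟨Kt, hKt⟩ := htr.exists_moment hr le_rfl o
  obtain ⟨Kh, hKh⟩ := hhat.exists_moment hr le_rfl o
  refine ⟨fun a ha => ⟨hΨ.integrable_payoff hA Ptr hKt ha, hΨ.integrable_payoff hA Phat hKh ha⟩,
    ?_⟩
  have hAmb : AmbiguityAssumption T (fun t ω => {Phat t ω}) o Kh LPhat :=
    { nonempty := fun t _ ω => Set.singleton_nonempty _
      prob := by rintro t _ ω Q rfl; infer_instance
      moment := by rintro t ht ω Q rfl; exact hKh t ht ω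
      lipschitz := by
        rintro t ht ω ω' Q rfl r hr
        exact ⟨_, rfl, (hhat.lipschitz t ht ω ω').trans hr.le⟩ }
  obtain ⟨v, hup, a, ha, hlow⟩ := hΨ.exists_dynamic_value hA hAmb
  -- Testing under the reference law itself makes all errors zero, and the two bounds meet.
  have hvhat : value 𝒜 Ψ (pathLaw Phat T) = v := by
    refine le_antisymm (value_le fun a' ha' => ?_) (le_value ha ?_)
    · have h := hup Phat inferInstance Kh hKh (fun _ _ => 0)
        (by rintro t _ ω f _ Q rfl; simp) (by simp [iterExp_zero]) a' ha'
      simpa [iterExp_zero] using h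
    · have h := hlow Phat inferInstance Kh hKh (fun _ _ => 0)
        (fun t _ ω => ⟨_, rfl, fun f _ => by simp⟩) (by simp [iterExp_zero])
      simpa [iterExp_zero] using h
  -- The case `s = t` of `hfin`, where no expectation is taken.
  have hwfin : ∀ t < T, ∀ ω, wass 1 (Ptr t ω) (Phat t ω) ≠ ∞ := by
    intro t ht ω h
    have := hfin t ht t le_rfl ω
    simp [muNested, iterExp, h, hα] at this
  let c : ℕ → ℝ≥0 := fun s => LΨ * weight T α LA LPhat s
  let g : (t : ℕ) → Hist S t → ℝ≥0∞ := fun t ω => c t * wass 1 (Ptr t ω) (Phat t ω) ^ α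
  have hm0 : ∀ s < T, muNested Ptr α (fun u ω => wass 1 (Ptr u ω) (Phat u ω)) s 0 Fin.elim0 ≠ ∞ :=
    fun s hs => (hfin s hs 0 (Nat.zero_le s) _).ne
  have hgfin : ∀ s < T, iterExp Ptr g s 0 Fin.elim0 ≠ ∞ := by
    intro s hs
    rw [iterExp_const_mul_eq]
    exact ENNReal.mul_ne_top ENNReal.coe_ne_top (hm0 s hs)
  have hsum := sum_toReal_iterExp Ptr c (fun u ω => wass 1 (Ptr u ω) (Phat u ω)) hm0
  set B : ℝ≥0∞ := ∑ s ∈ Finset.range T, (c s : ℝ≥0∞) *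
    muNested Ptr α (fun u ω => wass 1 (Ptr u ω) (Phat u ω)) s 0 Fin.elim0 with hB
  have hBfin : B ≠ ∞ := ENNReal.sum_ne_top.2 fun s hs =>
    ENNReal.mul_ne_top ENNReal.coe_ne_top (hm0 s (Finset.mem_range.1 hs))
  have hupper : value 𝒜 Ψ (pathLaw Ptr T) ≤ ((v + B.toReal : ℝ) : EReal) := by
    refine value_le fun a' ha' => ?_
    rw [← hsum]
    refine hup Ptr inferInstance Kt hKt g ?_ hgfin a' ha'
    rintro t ht ω f hf Q rfl
    have h := hf.ofReal_integral_sub_le hα hα1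
      (ne_top_of_le_ne_top (momentBound_ne_top _ _ _) (hKt t ht ω))
      (ne_top_of_le_ne_top (momentBound_ne_top _ _ _) (hKh t ht ω))
      (ENNReal.coe_toNNReal (hwfin t ht ω)).ge
    rwa [ENNReal.coe_toNNReal (hwfin t ht ω)] at h
  have hlower : ((v - B.toReal : ℝ) : EReal) ≤ value 𝒜 Ψ (pathLaw Ptr T) := by
    refine le_value ha ?_
    rw [sub_le_iff_le_add, ← hsum]
    refine hlow Ptr inferInstance Kt hKt g (fun t ht ω => ⟨_, rfl, fun f hf => ?_⟩) hgfin
    have h := hf.ofReal_integral_sub_le hα hα1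
      (ne_top_of_le_ne_top (momentBound_ne_top _ _ _) (hKh t ht ω))
      (ne_top_of_le_ne_top (momentBound_ne_top _ _ _) (hKt t ht ω))
      ((wass_comm 1 (Phat t ω) (Ptr t ω)).trans
        (ENNReal.coe_toNNReal (hwfin t ht ω)).symm).le
    rwa [ENNReal.coe_toNNReal (hwfin t ht ω)] at h
  obtain ⟨y, hy, hy1, hy2⟩ := exists_coe_eq_of_le_of_le hlower hupper
  rw [hvhat, hy, ← EReal.coe_sub, EReal.abs_def]
  refine ENNReal.ofReal_le_of_le_toReal ?_
  rw [abs_le]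
  constructor <;> linarith

/-- Comparison of the robust and the true value for ambiguity sets that contain the true kernels
and have radius at most `b t * ε t` around them. -/
theorem robustness_bound (hA : ControlAssumption T 𝒜 LA) (hΨ : UtilityAssumption 𝒜 Ψ p α LΨ)
    {Amb : (t : ℕ) → Hist S t → Set (Measure S)} (hAmb : AmbiguityAssumption T Amb o K L)
    {ε : (t : ℕ) → Hist S t → ℝ≥0} (hε : ∀ t < T, ∃ b : ℝ≥0, 0 < b ∧ ∀ ω, ε t ω ≤ b)
    (hPtr : ∀ t < T, ∀ ω, Ptr t ω ∈ Amb t ω) (b : ℕ → ℝ≥0)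
    (hw : ∀ t < T, ∀ ω, ∀ Q ∈ Amb t ω, wass 1 (Ptr t ω) Q ≤ (b t * ε t ω : ℝ≥0)) {B : ℝ≥0∞}
    (hB : B = ∑ s ∈ Finset.range T, ((LΨ * weight T α LA L s * b s ^ α : ℝ≥0) : ℝ≥0∞) *
      muNested Ptr α (fun u ω => (ε u ω : ℝ≥0∞)) s 0 Fin.elim0) :
    (∀ a ∈ controls T 𝒜, Integrable (payoff Ψ a) (pathLaw Ptr T) ∧
      ∀ μ ∈ ambiguityLaws T Amb, Integrable (payoff Ψ a) μ) ∧
    0 ≤ value 𝒜 Ψ (pathLaw Ptr T) - robustValue 𝒜 Ψ (ambiguityLaws T Amb) ∧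
    value 𝒜 Ψ (pathLaw Ptr T) - robustValue 𝒜 Ψ (ambiguityLaws T Amb) ≤ (B : EReal) ∧
    B < ∞ := by
  have hα := hΨ.exponent_pos
  have hα1 := hΨ.exponent_le
  have hKt := hAmb.ambiguityLaws_moment hPtr
  have hm0 : ∀ s < T, muNested Ptr α (fun u ω => (ε u ω : ℝ≥0∞)) s 0 Fin.elim0 ≠ ∞ := by
    intro s hs
    obtain ⟨c, -, hc⟩ := hε s hs
    have hle : muNested Ptr α (fun u ω => (ε u ω : ℝ≥0∞)) s 0 Fin.elim0 ≤ (c : ℝ≥0∞) ^ α :=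
      iterExp_le_of_le Ptr (s := s) (fun ω => ENNReal.rpow_le_rpow (ENNReal.coe_le_coe.2 (hc ω)) hα.le)
        s 0 (Nat.zero_add s) _
    exact ne_top_of_le_ne_top (ENNReal.rpow_ne_top_of_nonneg hα.le ENNReal.coe_ne_top) hle
  let c : ℕ → ℝ≥0 := fun s => LΨ * weight T α LA L s * b s ^ α
  let g : (t : ℕ) → Hist S t → ℝ≥0∞ := fun t ω => c t * (ε t ω : ℝ≥0∞) ^ α
  have hgfin : ∀ s < T, iterExp Ptr g s 0 Fin.elim0 ≠ ∞ := by
    intro s hs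
    rw [iterExp_const_mul_eq Ptr c α fun u ω => (ε u ω : ℝ≥0∞)]
    exact ENNReal.mul_ne_top ENNReal.coe_ne_top (hm0 s hs)
  have hsum := sum_toReal_iterExp Ptr c (fun u ω => (ε u ω : ℝ≥0∞)) hm0
  rw [← hB] at hsum
  have hBfin : B ≠ ∞ := by
    rw [hB]
    exact ENNReal.sum_ne_top.2 fun s hs =>
      ENNReal.mul_ne_top ENNReal.coe_ne_top (hm0 s (Finset.mem_range.1 hs))
  obtain ⟨v, hup, a, ha, hlow⟩ := hΨ.exists_dynamic_value hA hAmb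
  have hupper : value 𝒜 Ψ (pathLaw Ptr T) ≤ ((v + B.toReal : ℝ) : EReal) := by
    refine value_le fun a' ha' => ?_
    rw [← hsum]
    refine hup Ptr inferInstance K hKt g ?_ hgfin a' ha'
    intro t ht ω f hf Q hQ
    have := hAmb.prob t ht ω Q hQ
    have h := hf.ofReal_integral_sub_le hα hα1 (hAmb.moment_ne_top ht (hPtr t ht ω))
      (hAmb.moment_ne_top ht hQ) (hw t ht ω Q hQ)
    refine h.trans_eq ?_
    simp only [g, c]
    rw [ENNReal.coe_mul (b t), ENNReal.mul_rpow_of_nonneg _ _ hα.le,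
      ENNReal.coe_mul (LΨ * weight T α LA L t), ENNReal.coe_rpow_of_nonneg _ hα.le, mul_assoc]
  -- For a law in the ambiguity class, the member to compare with is its own kernel `P t ω`, at zero
  -- error.
  have hlower : (v : EReal) ≤ robustValue 𝒜 Ψ (ambiguityLaws T Amb) := by
    refine le_robustValue ha ?_
    rintro _ ⟨P, hPm, hP, rfl⟩
    have h := hlow P hPm K (hAmb.ambiguityLaws_moment hP) (fun _ _ => 0)
      (fun t ht ω => ⟨P t ω, hP t ht ω, fun f _ => by simp⟩) (by simp [iterExp_zero])
    simpa [iterExp_zero] using h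
  have hle : robustValue 𝒜 Ψ (ambiguityLaws T Amb) ≤ value 𝒜 Ψ (pathLaw Ptr T) :=
    robustValue_le_value ⟨Ptr, inferInstance, hPtr, rfl⟩
  obtain ⟨x, hx, -, hx2⟩ := exists_coe_eq_of_le_of_le (hlower.trans hle) hupper
  obtain ⟨y, hy, hy1, -⟩ := exists_coe_eq_of_le_of_le hlower (hle.trans hupper)
  rw [hx, hy] at hle ⊢
  rw [← EReal.coe_sub]
  refine ⟨fun a ha => ⟨hΨ.integrable_payoff hA Ptr hKt ha, ?_⟩, ?_, ?_, hBfin.lt_top⟩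
  · rintro _ ⟨P, hPm, hP, rfl⟩
    exact hΨ.integrable_payoff hA P (hAmb.ambiguityLaws_moment hP) ha
  · exact EReal.coe_nonneg.2 (sub_nonneg.2 (EReal.coe_le_coe_iff.1 hle))
  · exact EReal_coe_le_coe_ennreal hBfin (by linarith)

theorem RadiusAssumption.le_add {ε : (t : ℕ) → Hist S t → ℝ≥0} {Lε : ℕ → ℝ≥0}
    (hε : RadiusAssumption T ε Lε) {t : ℕ} (ht : t < T) (ω ω' : Hist S t) :
    (ε t ω : ℝ≥0∞) ≤ ε t ω' + Lε t * pathDist ω ω' := by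
  have h := edist_triangle (ε t ω) (ε t ω') 0
  rw [edist_comm _ 0, edist_comm _ 0] at h
  have e : ∀ x : ℝ≥0, edist 0 x = (x : ℝ≥0∞) := by
    intro x
    rw [edist_nndist, NNReal.nndist_zero_eq_val]
  rw [e, e, add_comm] at h
  exact h.trans (by gcongr; exact hε.lipschitz t ht ω ω')

/-- A member of the ball at `ω` lies almost in the ball at `ω'`, because centre and radius move in a
Lipschitz way. Interpolating towards the new centre brings it inside, at a cost of at most the
excess. -/
theorem ambiguityAssumption_wassBall (hS : IsClosed S) (hconv : Convex ℝ S) {q : ℕ} (hq : 1 ≤ q)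
    {LPhat Lε : ℕ → ℝ≥0} {ε : (t : ℕ) → Hist S t → ℝ≥0}
    {Amb : (t : ℕ) → Hist S t → Set (Measure S)}
    (hhat : LipschitzKernels T q q Phat LPhat) (hε : RadiusAssumption T ε Lε)
    (hAmb : ∀ t < T, ∀ ω, Amb t ω = wassBall q (Phat t ω) (ε t ω)) (o : S) :
    ∃ K, AmbiguityAssumption T Amb o K (fun u => LPhat u + Lε u) := by
  have := hS.measurableSet.standardBorel
  have : Nonempty S := ⟨o⟩
  obtain ⟨Kh, hKh⟩ := hhat.exists_moment hq hq o
  have hb : ∀ t, ∃ b : ℝ≥0, t < T → ∀ ω, ε t ω ≤ b := by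
    intro t
    by_cases ht : t < T
    · obtain ⟨b, -, hb⟩ := hε.bounded t ht
      exact ⟨b, fun _ => hb⟩
    · exact ⟨0, fun h => absurd h ht⟩
  choose b hb using hb
  refine ⟨fun t => Kh t + b t, ⟨fun t ht ω => ?_, fun t ht ω Q hQ => ?_, fun t ht ω Q hQ => ?_,
    fun t ht ω ω' Q hQ s hs => ?_⟩⟩
  · rw [hAmb t ht]
    exact ⟨Phat t ω, hhat.moment t ht ω, by rw [wass_self hq]; exact bot_le⟩
  · rw [hAmb t ht] at hQ
    exact hQ.1.1
  · rw [hAmb t ht] at hQ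
    refine moment_le_of_wass_le (hKh t ht ω) (((wass_one_le hq _ _).trans hQ.2).trans ?_)
    exact_mod_cast hb t ht ω
  · rw [hAmb t ht] at hQ ⊢
    have := hQ.1.1
    have hlt : wass q (Phat t ω') Q < ε t ω' + s := by
      have h1 := wass_triangle hq (Phat t ω') (Phat t ω) Q
      have h2 := hhat.lipschitz t ht ω' ω
      have h3 := hε.le_add ht ω ω'
      have hsymm : pathDist ω' ω = pathDist ω ω' := by simp [pathDist, edist_comm]
      rw [hsymm] at h2
      calc wass q (Phat t ω') Q ≤ LPhat t * pathDist ω ω' + ε t ω :=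
            h1.trans (add_le_add h2 hQ.2)
        _ ≤ LPhat t * pathDist ω ω' + (ε t ω' + Lε t * pathDist ω ω') := by gcongr
        _ = ε t ω' + ((LPhat t + Lε t : ℝ≥0) : ℝ≥0∞) * pathDist ω ω' := by
            rw [ENNReal.coe_add]; ring
        _ < ε t ω' + s := ENNReal.add_lt_add_left ENNReal.coe_ne_top hs
    obtain ⟨ρ, hρ, hρ1, hρ2⟩ :=
      exists_wass_interpolation hconv hq (hhat.moment t ht ω') hQ.1 hlt
    have := hρ.1
    refine ⟨ρ, ⟨hρ, hρ1⟩, ?_⟩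
    rw [wass_comm]
    exact (wass_one_le hq _ _).trans hρ2

theorem exists_mem_segment_dist_le {k : ℕ} {Θ : Set (Euc k)} (hΘ : Convex ℝ Θ) {x y : Euc k}
    (hx : x ∈ Θ) (hy : y ∈ Θ) {r s : ℝ} (hr : 0 ≤ r) (hs : 0 ≤ s) (h : dist x y ≤ r + s) :
    ∃ z ∈ Θ, dist z x ≤ r ∧ dist y z ≤ s := by
  rcases (add_nonneg hr hs).eq_or_lt with h0 | h0
  · have hxy : x = y := dist_le_zero.1 (h.trans h0.ge)
    exact ⟨x, hx, by simpa using hr, by simpa [hxy] using hs⟩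
  · have e : 1 - r / (r + s) = s / (r + s) := by field_simp; ring
    refine ⟨AffineMap.lineMap x y (r / (r + s)), hΘ.lineMap_mem hx hy
      ⟨by positivity, (div_le_one h0).2 (by linarith)⟩, ?_, ?_⟩
    · rw [dist_lineMap_left, Real.norm_of_nonneg (by positivity), div_mul_eq_mul_div,
        div_le_iff₀ h0]
      exact mul_le_mul_of_nonneg_left h hr
    · rw [dist_comm, dist_lineMap_right, e, Real.norm_of_nonneg (by positivity),
        div_mul_eq_mul_div, div_le_iff₀ h0]
      exact mul_le_mul_of_nonneg_left h hs

/-- The argument for Wasserstein balls is carried out in the convex set `Θ t`: the parameter moves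
along a segment towards the new centre, and the Lipschitz family transports this to the measures. -/
theorem ambiguityAssumption_paramBall {r : ℕ} (hr : 1 ≤ r) {D : ℕ → ℕ}
    {Θ : (t : ℕ) → Set (Euc (D t))} {Pfam : (t : ℕ) → Euc (D t) → Measure S}
    {θhat : (t : ℕ) → Hist S t → Euc (D t)} {LPfam Lθhat Lε : ℕ → ℝ≥0}
    {ε : (t : ℕ) → Hist S t → ℝ≥0} {Amb : (t : ℕ) → Hist S t → Set (Measure S)}
    (hpar : ParametricAssumption T r Θ Pfam LPfam θhat Lθhat) (hε : RadiusAssumption T ε Lε)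
    (hAmb : ∀ t < T, ∀ ω, Amb t ω = paramBall (Θ t) (Pfam t) (θhat t ω) (ε t ω))
    (hhat : ∀ t < T, ∀ ω, Phat t ω = Pfam t (θhat t ω)) (o : S) :
    ∃ K, AmbiguityAssumption T Amb o K (fun u => LPfam u * (Lθhat u + Lε u)) := by
  have hLip : LipschitzKernels T r r Phat (fun u => LPfam u * Lθhat u) :=
    { moment := fun t ht ω => by
        rw [hhat t ht]; exact hpar.moment t ht _ (hpar.mem t ht ω)
      lipschitz := fun t ht ω ω' => by
        rw [hhat t ht, hhat t ht, ENNReal.coe_mul, mul_assoc]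
        exact (hpar.lipschitz_family t ht _ (hpar.mem t ht ω) _ (hpar.mem t ht ω')).trans
          (by gcongr; exact hpar.lipschitz t ht ω ω') }
  obtain ⟨Kh, hKh⟩ := hLip.exists_moment hr hr o
  have hb : ∀ t, ∃ b : ℝ≥0, t < T → ∀ ω, ε t ω ≤ b := by
    intro t
    by_cases ht : t < T
    · obtain ⟨b, -, hb⟩ := hε.bounded t ht
      exact ⟨b, fun _ => hb⟩
    · exact ⟨0, fun h => absurd h ht⟩
  choose b hb using hb
  refine ⟨fun t => Kh t + LPfam t * b t, ⟨fun t ht ω => ?_, fun t ht ω Q hQ => ?_,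
    fun t ht ω Q hQ => ?_, fun t ht ω ω' Q hQ s hs => ?_⟩⟩
  · rw [hAmb t ht]
    exact ⟨_, θhat t ω, hpar.mem t ht ω, by simp, rfl⟩
  · rw [hAmb t ht] at hQ
    obtain ⟨x, hx, -, rfl⟩ := hQ
    exact (hpar.moment t ht x hx).1
  · rw [hAmb t ht] at hQ
    obtain ⟨x, hx, hxd, rfl⟩ := hQ
    refine moment_le_of_wass_le (hKh t ht ω) ((wass_one_le hr _ _).trans ?_)
    rw [hhat t ht]
    refine (hpar.lipschitz_family t ht _ (hpar.mem t ht ω) x hx).trans ?_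
    rw [ENNReal.coe_mul]
    gcongr
    rw [edist_comm, edist_nndist]
    exact_mod_cast le_trans (show nndist x (θhat t ω) ≤ ε t ω from hxd) (hb t ht ω)
  · rw [hAmb t ht] at hQ ⊢
    obtain ⟨x, hx, hxd, rfl⟩ := hQ
    set Δ : ℝ≥0 := ∑ i, nndist (ω i) (ω' i) with hΔ
    have h1 : edist (θhat t ω') x ≤ ((ε t ω' + (Lθhat t + Lε t) * Δ : ℝ≥0) : ℝ≥0∞) := by
      have hl := hpar.lipschitz t ht ω' ω
      have hsymm : pathDist ω' ω = pathDist ω ω' := by simp [pathDist, edist_comm]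
      rw [hsymm] at hl
      have hx' : edist (θhat t ω) x ≤ ε t ω := by
        rw [edist_comm, edist_nndist]
        exact_mod_cast hxd
      calc edist (θhat t ω') x ≤ Lθhat t * pathDist ω ω' + ε t ω :=
            (edist_triangle _ (θhat t ω) _).trans (add_le_add hl hx')
        _ ≤ Lθhat t * pathDist ω ω' + (ε t ω' + Lε t * pathDist ω ω') := by
            gcongr; exact hε.le_add ht ω ω'
        _ = _ := by
            rw [pathDist_eq_coe, ← hΔ]
            push_cast
            ring
    have h2 : dist (θhat t ω') x ≤ (ε t ω' : ℝ) + ((Lθhat t + Lε t) * Δ : ℝ≥0) := by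
      rw [edist_nndist] at h1
      exact_mod_cast h1
    obtain ⟨z, hz, hz1, hz2⟩ := exists_mem_segment_dist_le (hpar.convex t ht)
      (hpar.mem t ht ω') hx (NNReal.coe_nonneg _) (NNReal.coe_nonneg _) h2
    refine ⟨_, ⟨z, hz, hz1, rfl⟩, ?_⟩
    have := (hpar.moment t ht x hx).1
    refine (wass_one_le hr _ _).trans ((hpar.lipschitz_family t ht x hx z hz).trans
      (le_trans ?_ hs.le))
    rw [ENNReal.coe_mul, mul_assoc, pathDist_eq_coe, ← hΔ]
    gcongr
    rw [edist_nndist]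
    exact_mod_cast hz2

end Main

end

end RobustControl

/-- Values are extended reals, and `x - y` is `⊥` or `⊤` in `EReal` as soon as `x` or `y` is
infinite, while `EReal.abs` of both is `⊤`; so the bounds below contain the finiteness of all the
values. -/
theorem theorem5p1 {d : ℕ} (Ωloc : Set (Euc d)) (hΩ : IsClosed Ωloc) (T : ℕ) (hT : 0 < T)
    -- controls and utility function
    (m : ℕ → ℕ) (𝒜 : (t : ℕ) → Hist Ωloc t → Set (Euc (m t))) (LA : ℕ → ℝ≥0)
    (hA : ControlAssumption T 𝒜 LA)
    (Ψ : Hist Ωloc T → Actions m T → ℝ) (p : ℕ) (α : ℝ) (LΨ : ℝ≥0)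
    (hΨ : UtilityAssumption 𝒜 Ψ p α LΨ)
    -- true kernels and reference kernels
    (Ptr Phat : (t : ℕ) → Kernel (Hist Ωloc t) Ωloc)
    [∀ t, IsMarkovKernel (Ptr t)] [∀ t, IsMarkovKernel (Phat t)] :
    -- (1) stability
    (∀ LPtr LPhat : ℕ → ℝ≥0,
      LipschitzKernels T (max 1 p) 1 Ptr LPtr →
      LipschitzKernels T (max 1 p) 1 Phat LPhat →
      (∀ s < T, ∀ t ≤ s, ∀ ω,
        muNested Ptr α (fun u ω => wass 1 (Ptr u ω) (Phat u ω)) s t ω < ∞) →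
      (∀ a ∈ controls T 𝒜, Integrable (payoff Ψ a) (pathLaw Ptr T) ∧
        Integrable (payoff Ψ a) (pathLaw Phat T)) ∧
      (value 𝒜 Ψ (pathLaw Ptr T) - value 𝒜 Ψ (pathLaw Phat T)).abs ≤
        (LΨ : ℝ≥0∞) * ∑ s ∈ Finset.range T, (weight T α LA LPhat s : ℝ≥0∞) *
          muNested Ptr α (fun u ω => wass 1 (Ptr u ω) (Phat u ω)) s 0 Fin.elim0 ∧
      (LΨ : ℝ≥0∞) * ∑ s ∈ Finset.range T, (weight T α LA LPhat s : ℝ≥0∞) *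
          muNested Ptr α (fun u ω => wass 1 (Ptr u ω) (Phat u ω)) s 0 Fin.elim0 < ∞) ∧
    -- (2) robust versus non-robust, Wasserstein balls around the reference kernels
    (∀ (q : ℕ) (LPtr LPhat Lε : ℕ → ℝ≥0) (ε : (t : ℕ) → Hist Ωloc t → ℝ≥0)
      (Amb : (t : ℕ) → Hist Ωloc t → Set (Measure Ωloc)),
      1 ≤ q → p < q → Convex ℝ Ωloc →
      LipschitzKernels T q q Phat LPhat →
      RadiusAssumption T ε Lε →
      (∀ t < T, ∀ ω, Amb t ω = wassBall q (Phat t ω) (ε t ω)) →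
      LipschitzKernels T (max 1 p) 1 Ptr LPtr →
      (∀ t < T, ∀ ω, Ptr t ω ∈ wassBall q (Phat t ω) (ε t ω)) →
      (∀ a ∈ controls T 𝒜, Integrable (payoff Ψ a) (pathLaw Ptr T) ∧
        ∀ μ ∈ ambiguityLaws T Amb, Integrable (payoff Ψ a) μ) ∧
      0 ≤ value 𝒜 Ψ (pathLaw Ptr T) - robustValue 𝒜 Ψ (ambiguityLaws T Amb) ∧
      value 𝒜 Ψ (pathLaw Ptr T) - robustValue 𝒜 Ψ (ambiguityLaws T Amb) ≤
        (((2 : ℝ≥0∞) ^ α * LΨ * ∑ s ∈ Finset.range T,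
          (weight T α LA (fun u => LPhat u + Lε u) s : ℝ≥0∞) *
            muNested Ptr α (fun u ω => (ε u ω : ℝ≥0∞)) s 0 Fin.elim0 : ℝ≥0∞) : EReal) ∧
      (2 : ℝ≥0∞) ^ α * LΨ * ∑ s ∈ Finset.range T,
          (weight T α LA (fun u => LPhat u + Lε u) s : ℝ≥0∞) *
            muNested Ptr α (fun u ω => (ε u ω : ℝ≥0∞)) s 0 Fin.elim0 < ∞) ∧
    -- (3) robust versus non-robust, balls of parameters around the reference parameters
    (∀ (D : ℕ → ℕ) (Θ : (t : ℕ) → Set (Euc (D t)))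
      (Pfam : (t : ℕ) → Euc (D t) → Measure Ωloc)
      (θhat θtr : (t : ℕ) → Hist Ωloc t → Euc (D t)) (LPfam Lθhat Lθtr Lε : ℕ → ℝ≥0)
      (ε : (t : ℕ) → Hist Ωloc t → ℝ≥0)
      (Amb : (t : ℕ) → Hist Ωloc t → Set (Measure Ωloc)),
      ParametricAssumption T (max 1 p) Θ Pfam LPfam θhat Lθhat →
      RadiusAssumption T ε Lε →
      (∀ t < T, ∀ ω, Amb t ω = paramBall (Θ t) (Pfam t) (θhat t ω) (ε t ω)) →
      (∀ t < T, ∀ ω, Phat t ω = Pfam t (θhat t ω)) →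
      (∀ t < T, ∀ ω, Ptr t ω = Pfam t (θtr t ω)) →
      (∀ t < T, ∀ ω, θtr t ω ∈ Θ t) →
      (∀ t < T, ∀ ω ω', edist (θtr t ω) (θtr t ω') ≤ Lθtr t * pathDist ω ω') →
      (∀ t < T, ∀ ω, dist (θtr t ω) (θhat t ω) ≤ ε t ω) →
      (∀ a ∈ controls T 𝒜, Integrable (payoff Ψ a) (pathLaw Ptr T) ∧
        ∀ μ ∈ ambiguityLaws T Amb, Integrable (payoff Ψ a) μ) ∧
      0 ≤ value 𝒜 Ψ (pathLaw Ptr T) - robustValue 𝒜 Ψ (ambiguityLaws T Amb) ∧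
      value 𝒜 Ψ (pathLaw Ptr T) - robustValue 𝒜 Ψ (ambiguityLaws T Amb) ≤
        (((2 : ℝ≥0∞) ^ α * LΨ * ∑ s ∈ Finset.range T,
          (weight T α LA (fun u => LPfam u * (Lθhat u + Lε u)) s : ℝ≥0∞) *
            (LPfam s : ℝ≥0∞) ^ α *
            muNested Ptr α (fun u ω => (ε u ω : ℝ≥0∞)) s 0 Fin.elim0 : ℝ≥0∞) : EReal) ∧
      (2 : ℝ≥0∞) ^ α * LΨ * ∑ s ∈ Finset.range T,
          (weight T α LA (fun u => LPfam u * (Lθhat u + Lε u)) s : ℝ≥0∞) *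
            (LPfam s : ℝ≥0∞) ^ α *
            muNested Ptr α (fun u ω => (ε u ω : ℝ≥0∞)) s 0 Fin.elim0 < ∞) := by

  -- A probability measure lives on a non-empty space; this gives the reference point `o`.
  have hne : Nonempty Ωloc := (Ptr 0 Fin.elim0).nonempty_of_neZero
  obtain ⟨o⟩ := hne
  have hα := hΨ.exponent_pos
  refine ⟨fun LPtr LPhat htr hhat hfin => ?_,
    fun q LPtr LPhat Lε ε Amb hq _ hconv hhat hε hAmb _ hPtr => ?_,
    fun D Θ Pfam θhat θtr LPfam Lθhat Lθtr Lε ε Amb hpar hε hAmb hhat htr hmem _ hdist => ?_⟩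
  · have hB : (LΨ : ℝ≥0∞) * ∑ s ∈ Finset.range T, (weight T α LA LPhat s : ℝ≥0∞) *
          muNested Ptr α (fun u ω => wass 1 (Ptr u ω) (Phat u ω)) s 0 Fin.elim0 =
        ∑ s ∈ Finset.range T, ((LΨ * weight T α LA LPhat s : ℝ≥0) : ℝ≥0∞) *
          muNested Ptr α (fun u ω => wass 1 (Ptr u ω) (Phat u ω)) s 0 Fin.elim0 := by
      rw [Finset.mul_sum]
      exact Finset.sum_congr rfl fun s _ => by rw [ENNReal.coe_mul, mul_assoc]
    rw [hB]
    obtain ⟨h1, h2⟩ := stability_bound Ptr Phat hA hΨ o (le_max_left 1 p) htr hhat hfin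
    exact ⟨h1, h2, ENNReal.sum_lt_top.2 fun s hs => ENNReal.mul_lt_top ENNReal.coe_lt_top
      (hfin s (Finset.mem_range.1 hs) 0 (Nat.zero_le s) _)⟩
  · have := hΩ.measurableSet.standardBorel
    have : Nonempty Ωloc := ⟨o⟩
    obtain ⟨K, hK⟩ := ambiguityAssumption_wassBall Phat hΩ hconv hq hhat hε hAmb o
    -- The factor 2 is the triangle inequality through the centre of the ball; raised to the power
    -- `α` it becomes the prefactor of the bound.
    refine robustness_bound Ptr hA hΨ hK hε.bounded
      (fun t ht ω => by rw [hAmb t ht]; exact hPtr t ht ω) (fun _ => 2) ?_ ?_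
    · intro t ht ω Q hQ
      rw [hAmb t ht] at hQ
      have h := wass_triangle hq (Ptr t ω) (Phat t ω) Q
      rw [wass_comm q (Ptr t ω) (Phat t ω)] at h
      refine (wass_one_le hq _ _).trans (h.trans ((add_le_add (hPtr t ht ω).2 hQ.2).trans_eq ?_))
      push_cast
      ring
    · rw [Finset.mul_sum]
      refine Finset.sum_congr rfl fun s _ => ?_
      rw [ENNReal.coe_mul, ENNReal.coe_mul, ENNReal.coe_rpow_of_nonneg _ hα.le]
      push_cast
      ring
  · obtain ⟨K, hK⟩ := ambiguityAssumption_paramBall Phat (le_max_left 1 p) hpar hε hAmb hhat o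
    -- Parameters in the ball are within `2 * ε` of the true one, and the family stretches this by
    -- `LPfam t`.
    refine robustness_bound Ptr hA hΨ hK hε.bounded (fun t ht ω => ?_) (fun t => LPfam t * 2) ?_ ?_
    · rw [hAmb t ht, htr t ht]
      exact ⟨_, hmem t ht ω, hdist t ht ω, rfl⟩
    · intro t ht ω Q hQ
      rw [hAmb t ht] at hQ
      obtain ⟨x, hx, hxd, rfl⟩ := hQ
      refine (wass_one_le (le_max_left 1 p) _ _).trans ?_
      rw [htr t ht]
      refine (hpar.lipschitz_family t ht _ (hmem t ht ω) x hx).trans ?_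
      have hd : nndist (θtr t ω) x ≤ 2 * ε t ω := by
        have h1 := dist_triangle_right (θtr t ω) x (θhat t ω)
        have h2 := hdist t ht ω
        rw [← NNReal.coe_le_coe]
        push_cast
        linarith
      rw [mul_assoc, ENNReal.coe_mul, edist_nndist]
      gcongr
    · rw [Finset.mul_sum]
      refine Finset.sum_congr rfl fun s _ => ?_
      rw [ENNReal.coe_mul, ENNReal.coe_mul, ENNReal.coe_rpow_of_nonneg _ hα.le, ENNReal.coe_mul,
        ENNReal.mul_rpow_of_nonneg _ _ hα.le]
      push_cast
      ring
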